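/- **Setting.** Let $\boldsymbol\gamma=(\gamma_j)_{j\ge1}$ be positive weights. For $s\in\mathbb N$ let $\mathcal H(K_{s,\boldsymbol\gamma})$ be the weighted anchored Sobolev space with anchor $(1,\dots,1)$, i.e. the reproducing kernel Hilbert space of functions on $[0,1]^s$ with kernel $$K_{s,\boldsymbol\gamma}(\boldsymbol x,\boldsymbol y)=\prod_{j=1}^s\bigl(1+\gamma_j\min(1-x_j,1-y_j)\bigr).$$ For a sequence $\mathcal S=(\boldsymbol x_n)_{n\ge0}$ in $[0,1]^s$ and $N\ge1$ let $$e_{N,s}(\mathcal S)=\sup_{\|f\|\le1}\Bigl|\int_{[0,1]^s}f(\boldsymbol x)\,d\boldsymbol x-\frac1N\sum_{n=0}^{N-1}f(\boldsymbol x_n)\Bigr|,$$ where $f$ ranges over the unit ball of $\mathcal H(K_{s,\boldsymbol\gamma})$, and let $e_{0,s}=\sup_{\|f\|\le1}|\int f|$ be the initial error. If $\mathcal S$ is random, its root mean square (RMS) worst-case error is $(\mathbb E[e_{N,s}(\mathcal S)^2])^{1/2}$. Let $p_j$ be the $j$-th prime. For a prime $p$, the Monna map is $\phi_p:\mathbb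 Z_p\to[0,1)$, $\sum_{r\ge0}z_rp^r\mapsto\sum_{r\ge0}z_rp^{-r-1}\pmod 1$ (digits $z_r\in\{0,\dots,p-1\}$), and $\phi_p^+:[0,1)\to\mathbb Z_p$ maps $\sum_r x_rp^{-r-1}$ to $\sum_r x_rp^r$, the finite expansion being used whenever there is one. For $\boldsymbol\sigma\in[0,1)^s$ the $\boldsymbol p$-adically shifted Halton sequence is the sequence of the points with coordinates $\phi_{p_j}\bigl(\phi_{p_j}^+(\phi_{p_j}(n))+\phi_{p_j}^+(\sigma_j)\bigr)$, $1\le j\le s$, $n\ge0$. Let $\widehat e_{N,s}$ be its RMS worst-case error when $\boldsymbol\sigma$ is uniformly distributed on $[0,1)^s$. For an error $e(N,s)$ ($e(0,s)$ being the initial error), let $n(\varepsilon,s)$ be the least $N$ with $e(N,s)\le\varepsilon$ (absolute criterion), respectively with $e(N,s)\le\varepsilon\, e(0,s)$ (normalized criterion). The rule satisfies a strong polynomial tractability bound with exponent $\tau$ if there is $C>0$ with $n(\varepsilon,s)\le C\varepsilon^{-\tau}$ for all $\varepsilon\in(0,1)$ and $s\ge1$; its $\varepsilon$-exponent is the infimum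 of all such $\tau\ge0$. **Corollary.** Suppose that $\sum_{j\ge1}\gamma_j\,j^2\log j<\infty$. Then: 1. The squared worst-case error of the shifted Halton sequence is integrable in $\boldsymbol\sigma$, and for every $\delta>0$ there is a constant $C>0$, depending only on $\delta$ and $\boldsymbol\gamma$ and not on $s$ or $N$, such that $\widehat e_{N,s}\le C\,N^{-1+\delta}$ for all $s\ge1$ and all $N\ge1$. 2. Consequently, under either error criterion, the rule based on the randomly $\boldsymbol p$-adically shifted Halton sequence achieves strong polynomial tractability, and its $\varepsilon$-exponent is equal to $1$. 3. This is optimal: if, for some family of (deterministic or random) sequences, one in each dimension $s$, the open type quasi-Monte Carlo rules that use the first $N$ points satisfy, with respect to the (RMS) worst-case error and either criterion, a strong polynomial tractability bound with exponent $\tau$, then $\tau\ge1$. Moreover, for no $s\ge1$ and no sequence $\mathcal S$ in $[0,1]^s$ is $e_{N,s}(\mathcal S)=o(1/N)$ as $N\to\infty$. -/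

import Mathlib

open scoped NNReal ENNReal

namespace HaltonQMC

open MeasureTheory

noncomputable section

/-! ### The weighted anchored Sobolev space -/

/-- The closed unit cube `[0,1]^s`, with its Lebesgue (product) measure. -/
abbrev UnitCube (s : ℕ) : Type := Fin s → unitInterval

/-- The scalar kernel `∏_{j=1}^s (1 + γ_j min (1 - x_j, 1 - y_j))`. Weights are indexed from `1`,
so that the coordinate `i : Fin s` carries the weight `γ (i + 1)`. -/
def sobolevKernelFun (γ : ℕ → ℝ≥0) (s : ℕ) (x y : UnitCube s) : ℝ :=
  ∏ i : Fin s, (1 + (γ (i + 1) : ℝ) * min (1 - (x i : ℝ)) (1 - (y i : ℝ)))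

/-- The same kernel in the operator-valued form of `RKHS.OfKernel`: a scalar acts on `ℝ` by
multiplication. -/
def sobolevKernel (γ : ℕ → ℝ≥0) (s : ℕ) : Matrix (UnitCube s) (UnitCube s) (ℝ →L[ℝ] ℝ) :=
  Matrix.of fun x y => sobolevKernelFun γ s x y • ContinuousLinearMap.id ℝ ℝ

lemma posSemidef_of_finset {ι : Type*} {A : Matrix ι ι ℝ}
    (h : ∀ t : Finset ι, (A.submatrix ((↑) : t → ι) (↑)).PosSemidef) : A.PosSemidef := by
  classical
  refine ⟨?_, fun x => ?_⟩
  · ext i j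
    have := (h {i, j}).1.apply ⟨i, by simp⟩ ⟨j, by simp⟩
    simpa using this
  · have hA := h x.support
    simpa [Finsupp.sum, ← Finset.sum_attach x.support, ← Finset.subtype_mem_eq_attach,
      ← Finsupp.subtypeDomain_apply, ← Finsupp.support_subtypeDomain] using
      hA.2 (x.subtypeDomain (· ∈ x.support))

lemma posSemidef_min {ι : Type*} (a : ι → ℝ) (ha : ∀ i, 0 ≤ a i) :
    (Matrix.of fun i j => min (a i) (a j)).PosSemidef := by
  refine posSemidef_of_finset fun t => ?_
  have := posSemidef_matrix_measure_inter (μ := (volume : Measure ℝ))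
    (s := fun i : t => Set.Ioc 0 (a i)) (fun _ => measurableSet_Ioc) (fun _ => by simp)
  convert this using 1
  ext i j
  simp [Set.Ioc_inter_Ioc, ha]

lemma posSemidef_sobolevKernelFun (γ : ℕ → ℝ≥0) (s : ℕ) :
    (Matrix.of (sobolevKernelFun γ s)).PosSemidef := by
  classical
  have hone : (Matrix.of fun _ _ : UnitCube s => (1 : ℝ)).PosSemidef := by
    simpa using posSemidef_min (fun _ : UnitCube s => (1 : ℝ)) (fun _ => zero_le_one)
  have key : ∀ t : Finset (Fin s), (Matrix.of fun x y : UnitCube s =>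
      ∏ i ∈ t, (1 + (γ (i + 1) : ℝ) * min (1 - (x i : ℝ)) (1 - (y i : ℝ)))).PosSemidef := by
    intro t
    induction t using Finset.induction_on with
    | empty => simpa using hone
    | insert i t hi ih =>
      have hmin := posSemidef_min (fun x : UnitCube s => 1 - (x i : ℝ))
        (fun x => sub_nonneg.2 (x i).2.2)
      have hfac := hone.add (hmin.smul (γ (i + 1)).2)
      have hprod := Matrix.PosSemidef.hadamard (𝕜 := ℝ) hfac ih
      refine (congrArg Matrix.PosSemidef ?_).mpr hprod
      ext x y
      simp only [Matrix.of_apply, Finset.prod_insert hi]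
      rfl
  exact key Finset.univ

instance fact_posSemidef_sobolevKernel (γ : ℕ → ℝ≥0) (s : ℕ) :
    Fact (sobolevKernel γ s).PosSemidef := by
  have htfae := RKHS.posSemidef_tfae (K := sobolevKernel γ s)
  have hiff := htfae.out 0 2
  refine ⟨hiff.2 (And.intro ?_ fun v => ?_)⟩
  · ext x y
    have := (posSemidef_sobolevKernelFun γ s).1.apply x y
    simp only [Matrix.of_apply, star_trivial] at this
    have hid : star (ContinuousLinearMap.id ℝ ℝ) = ContinuousLinearMap.id ℝ ℝ :=
      star_one (ℝ →L[ℝ] ℝ)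
    simp [sobolevKernel, Matrix.conjTranspose_apply, this, hid]
  · have := (posSemidef_sobolevKernelFun γ s).2 v
    simp only [Finsupp.sum, Matrix.of_apply, star_trivial] at this
    rw [Finset.sum_comm] at this
    simpa [sobolevKernel, Finsupp.sum, mul_comm, mul_assoc, mul_left_comm] using this

/-- The weighted anchored Sobolev space with anchor `(1, …, 1)`: the reproducing kernel Hilbert
space of functions on `[0,1]^s` with kernel `∏_{j=1}^s (1 + γ_j min (1 - x_j, 1 - y_j))`. -/
abbrev SobolevSpace (γ : ℕ → ℝ≥0) (s : ℕ) : Type := RKHS.OfKernel (sobolevKernel γ s)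

/-! ### Worst-case errors of quasi-Monte Carlo rules -/

/-- The worst-case error, over the unit ball of the Sobolev space, of the equal-weight rule that
uses the first `N` points of the sequence `S`. For `N = 0` the rule is the zero rule, and this is
the initial error. -/
def worstCaseError (γ : ℕ → ℝ≥0) (s N : ℕ) (S : ℕ → UnitCube s) : ℝ :=
  ⨆ f : {f : SobolevSpace γ s // ‖f‖ ≤ 1},
    |(∫ x : UnitCube s, f.1 x) - 1 / (N : ℝ) * ∑ n ∈ Finset.range N, f.1 (S n)|

/-- The root mean square worst-case error of a rule based on a random sequence `S`. -/
def rmsWorstCaseError {Ω : Type*} [MeasurableSpace Ω] (P : Measure Ω) (γ : ℕ → ℝ≥0) (s N : ℕ)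
    (S : Ω → ℕ → UnitCube s) : ℝ :=
  √(∫ ω, worstCaseError γ s N (S ω) ^ 2 ∂P)

/-! ### Radical inverses, the Monna map, and `p`-adically shifted Halton sequences -/

section Padic

variable (p : ℕ) [Fact p.Prime]

/-- The radical inverse of `n` in base `p`; the `k`-th base `p` digit of `n` is
`⌊n / p ^ k⌋ mod p`. -/
def radicalInverse (n : ℕ) : ℝ :=
  Real.ofDigits fun k => Fin.ofNat p (n / p ^ k)

/-- The `r`-th digit of a `p`-adic integer `z = ∑ z_r p ^ r`; here `z.appr (r + 1)` is the
natural number `z_0 + z_1 p + ⋯ + z_r p ^ r`. -/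
def padicDigit (z : ℤ_[p]) (r : ℕ) : Fin p :=
  Fin.ofNat p (z.appr (r + 1) / p ^ r)

/-- The Monna map `∑ z_r p ^ r ↦ ∑ z_r / p ^ (r + 1) (mod 1)`. -/
def monnaMap (z : ℤ_[p]) : ℝ :=
  Int.fract (Real.ofDigits (padicDigit p z))

/-- The inverse Monna map `∑ x_r / p ^ (r + 1) ↦ ∑ x_r p ^ r` on `[0,1)`. The digits
`x_r = ⌊x p ^ (r + 1)⌋ mod p` are those of the finite expansion if `x` has one. -/
def invMonnaMap (x : ℝ) : ℤ_[p] :=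
  ∑' r : ℕ, ((Real.digits x p r : ℕ) : ℤ_[p]) * (p : ℤ_[p]) ^ r

/-- The `p`-adic shift of `x` by `σ`. -/
def padicShift (x σ : ℝ) : ℝ :=
  monnaMap p (invMonnaMap p x + invMonnaMap p σ)

lemma padicShift_mem (x σ : ℝ) : padicShift p x σ ∈ unitInterval :=
  ⟨Int.fract_nonneg _, (Int.fract_lt_one _).le⟩

end Padic

/-- The Halton sequence in the bases `p_1, …, p_s`, shifted by `σ ∈ [0,1)^s`. -/
def shiftedHalton {s : ℕ} (p : Fin s → ℕ) [∀ j, Fact (p j).Prime] (σ : Fin s → ℝ) (n : ℕ) :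
    UnitCube s :=
  fun j => ⟨padicShift (p j) (radicalInverse (p j) n) (σ j), padicShift_mem _ _ _⟩

/-- The law of a random shift: the uniform distribution on `[0,1)^s`. -/
def shiftLaw (s : ℕ) : Measure (Fin s → ℝ) :=
  volume.restrict (Set.univ.pi fun _ => Set.Ico 0 1)

/-- The first `s` primes: `Nat.nth Nat.Prime 0 = 2`. -/
def firstPrimes (s : ℕ) (j : Fin s) : ℕ := Nat.nth Nat.Prime j

instance fact_prime_firstPrimes (s : ℕ) (j : Fin s) : Fact (firstPrimes s j).Prime :=
  ⟨Nat.prime_nth_prime j⟩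

/-- The root mean square worst-case error of the randomly `p`-adically shifted Halton sequence in
the first `s` primes. -/
def haltonRMSError (γ : ℕ → ℝ≥0) (N s : ℕ) : ℝ :=
  rmsWorstCaseError (shiftLaw s) γ s N (shiftedHalton (firstPrimes s))

/-! ### Tractability -/

/-- The two usual error criteria of information-based complexity. -/
inductive ErrorCriterion
  | absolute
  | normalized

/-- The factor by which `ε` is multiplied: `1`, or the initial error `e 0 s`. Here `e N s` is the
error with `N` nodes in dimension `s`. -/
def ErrorCriterion.scale (c : ErrorCriterion) (e : ℕ → ℕ → ℝ) (s : ℕ) : ℝ :=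
  match c with
  | .absolute => 1
  | .normalized => e 0 s

/-- The least number of nodes for which the error in dimension `s` is at most `ε` (absolute
criterion) or at most `ε` times the initial error (normalized criterion); `⊤` if there is none. -/
def infoComplexity (e : ℕ → ℕ → ℝ) (c : ErrorCriterion) (ε : ℝ) (s : ℕ) : ℕ∞ :=
  sInf {n : ℕ∞ | ∃ N : ℕ, n = N ∧ e N s ≤ ε * c.scale e s}

/-- A strong polynomial tractability error bound with exponent `τ`: `C ε ^ (-τ)` nodes suffice for
all `ε ∈ (0,1)` and all dimensions, with `C` independent of both. -/
def StronglyTractableWith (e : ℕ → ℕ → ℝ) (c : ErrorCriterion) (τ : ℝ) : Prop :=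
  ∃ C : ℝ, 0 < C ∧ ∀ s : ℕ, 1 ≤ s → ∀ ε : ℝ, 0 < ε → ε < 1 →
    (infoComplexity e c ε s : ℝ≥0∞) ≤ ENNReal.ofReal (C * ε ^ (-τ))

/-- The `ε`-exponent of strong polynomial tractability is `τ₀`: it is the infimum of the
admissible exponents (and there are admissible ones, as the empty set of reals has no greatest
lower bound). -/
def HasEpsExponent (e : ℕ → ℕ → ℝ) (c : ErrorCriterion) (τ₀ : ℝ) : Prop :=
  IsGLB {τ : ℝ | 0 ≤ τ ∧ StronglyTractableWith e c τ} τ₀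

end

end HaltonQMC

namespace HaltonQMC

open MeasureTheory

/-! ### Integrals of the kernel -/

/-! By the reproducing property, the integration error of a rule is the inner product with a
representer `errorVec`. The worst-case error is the norm of this vector, and its square is a double
sum of kernel values (`worstCaseError_sq`). The coordinates of the shift are independent and every
shifted point is uniform, so averaging leaves the mean over `n, m` of `∏ⱼ (1 + γⱼ * shiftedMin n m)`
minus `∏ⱼ (1 + γⱼ / 3)` (`integral_worstCaseError_sq`).

Upper bound. The averaged one-dimensional kernel depends on `n - m` only and equals `1/3` plus a
series of levels; level `g` lives on the multiples of `p ^ g`, has period `p ^ (g + 1)` and mean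
zero (`sum_levelKernel_eq`, `tendsto_sum_levelKernel`). Expanding the product over the coordinates
gives, for each vector `l` of levels, a function of period `M = ∏ⱼ pⱼ ^ lⱼ`. By the Chinese
remainder theorem it has mean zero unless `l = 0`, and the term `l = 0` cancels the subtracted
product. In the double sum of a mean-zero periodic function only `N mod M` indices survive in each
variable (`abs_sum_sum_sub_le`), and `(N mod M) / M ≤ (N / M) ^ δ` turns the sum over `l` into a
product of geometric series with factors `1 + γⱼ O(pⱼ² / log pⱼ)`. Since `pⱼ = O(j log j)`, the
hypothesis on the weights bounds this product uniformly in the dimension.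

Lower bounds. In dimension one the squared error is `γ₁` times the mean square of the local
discrepancy, and `N` times the discrepancy at `t` is `N t` minus an integer, hence at least `|sin (π
N t)| / π` in absolute value. This gives order `1 / N` for deterministic and random rules alike and
excludes exponents below one. In any dimension, `N * e_N` and `(N + 1) * e_{N+1}` cannot both be
small, because the corresponding multiples of the representers differ by the representer of a
one-node rule, whose norm is bounded below (`le_norm_meanVec_sub_kernelVec`). -/

lemma integral_unitInterval (f : ℝ → ℝ) :
    ∫ x : unitInterval, f x = ∫ x in (0 : ℝ)..1, f x := by
  rw [intervalIntegral.integral_of_le zero_le_one, ← integral_Icc_eq_integral_Ioc]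
  exact integral_subtype measurableSet_Icc f

lemma integral_min_one_sub {x : ℝ} (hx : x ∈ unitInterval) :
    ∫ y in (0 : ℝ)..1, min (1 - x) (1 - y) = (1 - x ^ 2) / 2 := by
  have hc : Continuous fun y : ℝ => min (1 - x) (1 - y) := by fun_prop
  rw [← intervalIntegral.integral_add_adjacent_intervals (b := x) (hc.intervalIntegrable _ _)
    (hc.intervalIntegrable _ _)]
  have h1 : ∫ y in (0 : ℝ)..x, min (1 - x) (1 - y) = ∫ _ in (0 : ℝ)..x, (1 - x) := by
    refine intervalIntegral.integral_congr fun y hy => ?_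
    rw [Set.uIcc_of_le hx.1] at hy
    exact min_eq_left (by linarith [hy.2])
  have h2 : ∫ y in x..1, min (1 - x) (1 - y) = ∫ y in x..1, (1 - y) := by
    refine intervalIntegral.integral_congr fun y hy => ?_
    rw [Set.uIcc_of_le hx.2] at hy
    exact min_eq_right (by linarith [hy.1])
  rw [h1, h2, intervalIntegral.integral_const,
    intervalIntegral.integral_sub (by simp) (by simp), integral_id]
  simp
  ring

lemma integral_factor (c : ℝ) {x : ℝ} (hx : x ∈ unitInterval) :
    ∫ y : unitInterval, (1 + c * min (1 - x) (1 - (y : ℝ))) = 1 + c * ((1 - x ^ 2) / 2) := by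
  have hc : Continuous fun y : ℝ => c * min (1 - x) (1 - y) := by fun_prop
  rw [integral_unitInterval fun y => 1 + c * min (1 - x) (1 - y),
    intervalIntegral.integral_add (by simp) (hc.intervalIntegrable _ _),
    intervalIntegral.integral_const_mul, integral_min_one_sub hx]
  simp

lemma integral_factor_sq (c : ℝ) :
    ∫ x : unitInterval, (1 + c * ((1 - (x : ℝ) ^ 2) / 2)) = 1 + c / 3 := by
  rw [integral_unitInterval fun x => 1 + c * ((1 - x ^ 2) / 2)]
  have : ∀ x : ℝ, 1 + c * ((1 - x ^ 2) / 2) = (1 + c / 2) - c / 2 * x ^ 2 := fun x => by ring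
  simp_rw [this]
  rw [intervalIntegral.integral_sub (by simp)
    ((by fun_prop : Continuous fun x : ℝ => c / 2 * x ^ 2).intervalIntegrable _ _),
    intervalIntegral.integral_const_mul, integral_pow]
  simp
  ring

section Kernel

variable (γ : ℕ → ℝ≥0) (s : ℕ)

lemma continuous_sobolevKernelFun :
    Continuous fun q : UnitCube s × UnitCube s => sobolevKernelFun γ s q.1 q.2 := by
  unfold sobolevKernelFun
  fun_prop

/-- The integral of the kernel in one variable. -/
noncomputable def kernelMean (x : UnitCube s) : ℝ :=
  ∏ i : Fin s, (1 + (γ (i + 1) : ℝ) * ((1 - (x i : ℝ) ^ 2) / 2))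

lemma continuous_kernelMean : Continuous (kernelMean γ s) := by
  unfold kernelMean
  fun_prop

lemma integral_sobolevKernelFun (x : UnitCube s) :
    ∫ y, sobolevKernelFun γ s x y = kernelMean γ s x := by
  unfold sobolevKernelFun kernelMean
  rw [integral_fintype_prod_volume_eq_prod
    (f := fun (i : Fin s) (t : unitInterval) => 1 + (γ (i + 1) : ℝ) * min (1 - (x i : ℝ)) (1 - (t : ℝ)))]
  exact Finset.prod_congr rfl fun i _ => integral_factor _ (x i).2

lemma integral_kernelMean :
    ∫ x, kernelMean γ s x = ∏ i : Fin s, (1 + (γ (i + 1) : ℝ) / 3) := by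
  unfold kernelMean
  rw [integral_fintype_prod_volume_eq_prod
    (f := fun (i : Fin s) (t : unitInterval) => 1 + (γ (i + 1) : ℝ) * ((1 - (t : ℝ) ^ 2) / 2))]
  exact Finset.prod_congr rfl fun i _ => integral_factor_sq _

/-! ### The representer of the integration error -/

/-- The kernel function `K(·, x)` as an element of the Sobolev space. -/
noncomputable def kernelVec (x : UnitCube s) : SobolevSpace γ s :=
  RKHS.kerFun (SobolevSpace γ s) x (1 : ℝ)

lemma inner_kernelVec_left (x : UnitCube s) (f : SobolevSpace γ s) :
    inner ℝ (kernelVec γ s x) f = f x := by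
  simp [kernelVec]

lemma kernelVec_apply (x y : UnitCube s) : kernelVec γ s x y = sobolevKernelFun γ s y x := by
  rw [kernelVec, RKHS.kerFun_apply, RKHS.OfKernel.kernel_ofKernel]
  simp [sobolevKernel]

lemma sobolevKernelFun_comm (x y : UnitCube s) :
    sobolevKernelFun γ s x y = sobolevKernelFun γ s y x := by
  simp only [sobolevKernelFun, min_comm]

lemma inner_kernelVec (x y : UnitCube s) :
    inner ℝ (kernelVec γ s x) (kernelVec γ s y) = sobolevKernelFun γ s x y := by
  rw [inner_kernelVec_left, kernelVec_apply]

/-- The squared distance expands into kernel values, which are continuous. On the compact cube this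
gives the Bochner integrability behind `meanVec`. -/
lemma continuous_kernelVec : Continuous (kernelVec γ s) := by
  refine continuous_iff_continuousAt.2 fun x => tendsto_iff_norm_sub_tendsto_zero.2 ?_
  have hK := continuous_sobolevKernelFun γ s
  have h : ∀ y, ‖kernelVec γ s y - kernelVec γ s x‖ = √(sobolevKernelFun γ s y y
      - 2 * sobolevKernelFun γ s y x + sobolevKernelFun γ s x x) := fun y => by
    rw [← Real.sqrt_sq (norm_nonneg (_ - _)), norm_sub_sq_real, inner_kernelVec,
      ← real_inner_self_eq_norm_sq, ← real_inner_self_eq_norm_sq, inner_kernelVec,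
      inner_kernelVec]
  simp_rw [h]
  have hc : Continuous fun y => √(sobolevKernelFun γ s y y
      - 2 * sobolevKernelFun γ s y x + sobolevKernelFun γ s x x) := by
    have h1 : Continuous fun y => sobolevKernelFun γ s y y :=
      hK.comp (continuous_id.prodMk continuous_id)
    have h2 : Continuous fun y => sobolevKernelFun γ s y x :=
      hK.comp (continuous_id.prodMk continuous_const)
    fun_prop
  convert hc.tendsto x using 2
  ring_nf
  simp

lemma integrable_of_continuous {E : Type*} [NormedAddCommGroup E] {f : UnitCube s → E}
    (hf : Continuous f) : Integrable f :=
  hf.integrable_of_hasCompactSupport (HasCompactSupport.of_compactSpace f)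

/-- The representer of integration. -/
noncomputable def meanVec : SobolevSpace γ s := ∫ x, kernelVec γ s x

lemma inner_meanVec_left (f : SobolevSpace γ s) : inner ℝ (meanVec γ s) f = ∫ x, f x := by
  rw [meanVec, real_inner_comm,
    ← integral_inner (integrable_of_continuous s (continuous_kernelVec γ s))]
  exact integral_congr_ae (ae_of_all _ fun x =>
    (real_inner_comm _ _).trans (inner_kernelVec_left γ s x f))

lemma inner_meanVec_kernelVec (x : UnitCube s) :
    inner ℝ (meanVec γ s) (kernelVec γ s x) = kernelMean γ s x := by
  simp_rw [inner_meanVec_left, kernelVec_apply, sobolevKernelFun_comm γ s _ x,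
    integral_sobolevKernelFun]

lemma inner_meanVec_self :
    inner ℝ (meanVec γ s) (meanVec γ s) = ∏ i : Fin s, (1 + (γ (i + 1) : ℝ) / 3) := by
  rw [inner_meanVec_left, ← integral_kernelMean]
  refine integral_congr_ae (ae_of_all _ fun x => ?_)
  rw [← inner_kernelVec_left, real_inner_comm, inner_meanVec_kernelVec]

/-- The representer of the integration error of a rule. -/
noncomputable def errorVec (N : ℕ) (S : ℕ → UnitCube s) : SobolevSpace γ s :=
  meanVec γ s - (1 / (N : ℝ)) • ∑ n ∈ Finset.range N, kernelVec γ s (S n)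

lemma inner_errorVec_left (N : ℕ) (S : ℕ → UnitCube s) (f : SobolevSpace γ s) :
    inner ℝ (errorVec γ s N S) f
      = (∫ x, f x) - 1 / (N : ℝ) * ∑ n ∈ Finset.range N, f (S n) := by
  simp_rw [errorVec, inner_sub_left, inner_meanVec_left, real_inner_smul_left, sum_inner,
    inner_kernelVec_left]

/-- Cauchy–Schwarz, with equality at the normalized vector `g`. -/
lemma iSup_abs_inner_eq_norm {H : Type*} [NormedAddCommGroup H] [InnerProductSpace ℝ H] (g : H) :
    ⨆ f : {f : H // ‖f‖ ≤ 1}, |inner ℝ g f.1| = ‖g‖ := by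
  have hle : ∀ f : {f : H // ‖f‖ ≤ 1}, |inner ℝ g f.1| ≤ ‖g‖ := fun f =>
    (abs_real_inner_le_norm _ _).trans (mul_le_of_le_one_right (norm_nonneg _) f.2)
  have : Nonempty {f : H // ‖f‖ ≤ 1} := ⟨⟨0, by simp⟩⟩
  refine le_antisymm (ciSup_le hle) ?_
  rcases eq_or_ne g 0 with rfl | hg
  · simp
  have hn : ‖g‖ ≠ 0 := norm_ne_zero_iff.2 hg
  refine le_ciSup_of_le ⟨‖g‖, Set.forall_mem_range.2 hle⟩
    ⟨(‖g‖)⁻¹ • g, by rw [norm_smul, norm_inv, norm_norm, inv_mul_cancel₀ hn]⟩ ?_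
  rw [real_inner_smul_right, real_inner_self_eq_norm_sq]
  refine le_of_eq_of_le ?_ (le_abs_self _)
  field_simp

lemma worstCaseError_eq_norm (N : ℕ) (S : ℕ → UnitCube s) :
    worstCaseError γ s N S = ‖errorVec γ s N S‖ := by
  rw [← iSup_abs_inner_eq_norm]
  simp_rw [inner_errorVec_left]
  rfl

/-- The squared worst-case error in terms of the kernel. -/
lemma worstCaseError_sq (N : ℕ) (S : ℕ → UnitCube s) :
    worstCaseError γ s N S ^ 2 = ∏ i : Fin s, (1 + (γ (i + 1) : ℝ) / 3)
      - 2 / N * ∑ n ∈ Finset.range N, kernelMean γ s (S n)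
      + 1 / (N : ℝ) ^ 2 *
        ∑ n ∈ Finset.range N, ∑ m ∈ Finset.range N, sobolevKernelFun γ s (S n) (S m) := by
  have h (x : UnitCube s) : inner ℝ (kernelVec γ s x) (meanVec γ s) = kernelMean γ s x := by
    rw [real_inner_comm, inner_meanVec_kernelVec]
  rw [worstCaseError_eq_norm, ← real_inner_self_eq_norm_sq, errorVec, inner_sub_left,
    inner_sub_right, inner_sub_right, inner_meanVec_self]
  simp_rw [real_inner_smul_left, real_inner_smul_right, sum_inner, inner_sum,
    inner_kernelVec, inner_meanVec_kernelVec, h]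
  ring

lemma worstCaseError_nonneg (N : ℕ) (S : ℕ → UnitCube s) : 0 ≤ worstCaseError γ s N S := by
  rw [worstCaseError_eq_norm]
  exact norm_nonneg _

lemma worstCaseError_zero_sq (S : ℕ → UnitCube s) :
    worstCaseError γ s 0 S ^ 2 = ∏ i : Fin s, (1 + (γ (i + 1) : ℝ) / 3) := by
  simp [worstCaseError_sq]

lemma norm_kernelVec_sq_le (x : UnitCube s) :
    ‖kernelVec γ s x‖ ^ 2 ≤ ∏ i : Fin s, (1 + (γ (i + 1) : ℝ)) := by
  rw [← real_inner_self_eq_norm_sq, inner_kernelVec, sobolevKernelFun]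
  refine Finset.prod_le_prod (fun i _ => ?_) fun i _ => ?_
  · exact add_nonneg zero_le_one
      (mul_nonneg (γ _).coe_nonneg (le_min (sub_nonneg.2 (x i).2.2) (sub_nonneg.2 (x i).2.2)))
  · rw [min_self]
    have := mul_le_of_le_one_right (γ (i + 1)).coe_nonneg (by linarith [(x i).2.1] : 1 - (x i : ℝ) ≤ 1)
    simpa using this

/-- A crude bound uniform in the nodes, which serves for integrability in the random parameter. -/
lemma worstCaseError_le (N : ℕ) (S : ℕ → UnitCube s) :
    worstCaseError γ s N S ≤ ‖meanVec γ s‖ + √(∏ i : Fin s, (1 + (γ (i + 1) : ℝ))) := by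
  rw [worstCaseError_eq_norm, errorVec]
  refine (norm_sub_le _ _).trans (add_le_add le_rfl ?_)
  rw [norm_smul]
  have h : ‖∑ n ∈ Finset.range N, kernelVec γ s (S n)‖
      ≤ N * √(∏ i : Fin s, (1 + (γ (i + 1) : ℝ))) := by
    refine (norm_sum_le _ _).trans ((Finset.sum_le_sum fun n _ =>
      Real.le_sqrt_of_sq_le (norm_kernelVec_sq_le γ s (S n))).trans (by simp))
  rcases Nat.eq_zero_or_pos N with rfl | hN
  · simp
  · have hN' : (0 : ℝ) < N := by exact_mod_cast hN
    calc ‖1 / (N : ℝ)‖ * ‖∑ n ∈ Finset.range N, kernelVec γ s (S n)‖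
        ≤ ‖1 / (N : ℝ)‖ * (N * √(∏ i : Fin s, (1 + (γ (i + 1) : ℝ)))) := by gcongr
      _ = _ := by
        rw [Real.norm_of_nonneg (by positivity)]
        field_simp

lemma integrable_worstCaseError_sq {Ω : Type*} [MeasurableSpace Ω] (P : Measure Ω)
    [IsFiniteMeasure P] (N : ℕ) {S : Ω → ℕ → UnitCube s} (hS : ∀ n, Measurable fun ω => S ω n) :
    Integrable (fun ω => worstCaseError γ s N (S ω) ^ 2) P := by
  have hm : Measurable fun ω => worstCaseError γ s N (S ω) ^ 2 := by
    simp_rw [worstCaseError_sq]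
    have h1 : ∀ n, Measurable fun ω => kernelMean γ s (S ω n) := fun n =>
      (continuous_kernelMean γ s).measurable.comp (hS n)
    have h2 : ∀ n m, Measurable fun ω => sobolevKernelFun γ s (S ω n) (S ω m) := fun n m =>
      (continuous_sobolevKernelFun γ s).measurable.comp ((hS n).prodMk (hS m))
    fun_prop
  refine Integrable.of_bound hm.aestronglyMeasurable
    ((‖meanVec γ s‖ + √(∏ i : Fin s, (1 + (γ (i + 1) : ℝ)))) ^ 2) (ae_of_all _ fun ω => ?_)
  rw [Real.norm_of_nonneg (sq_nonneg _)]
  exact pow_le_pow_left₀ (worstCaseError_nonneg _ _ _ _) (worstCaseError_le _ _ _ _) 2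

end Kernel

/-! ### Lower bounds for the worst-case error -/

lemma integral_indicator_Ioi {x : ℝ} (hx : x ∈ unitInterval) (g : ℝ → ℝ) :
    ∫ t in (0 : ℝ)..1, (Set.Ioi x).indicator g t = ∫ t in x..1, g t := by
  rw [intervalIntegral.integral_of_le zero_le_one, intervalIntegral.integral_of_le hx.2,
    integral_indicator measurableSet_Ioi, Measure.restrict_restrict measurableSet_Ioi]
  congr 2
  ext t
  simp only [Set.mem_inter_iff, Set.mem_Ioi, Set.mem_Ioc]
  exact ⟨fun h => ⟨h.1, h.2.2⟩, fun h => ⟨h.1, hx.1.trans_lt h.1, h.2⟩⟩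

lemma intervalIntegrable_indicator_Ioi (x : ℝ) {g : ℝ → ℝ} (hg : Continuous g) :
    IntervalIntegrable ((Set.Ioi x).indicator g) volume 0 1 := by
  rw [intervalIntegrable_iff_integrableOn_Ioc_of_le zero_le_one]
  exact ((hg.integrableOn_Icc (a := (0 : ℝ)) (b := 1)).mono_set Set.Ioc_subset_Icc_self).indicator
    measurableSet_Ioi

lemma indicator_Ioi_mul_indicator_Ioi (x y t : ℝ) :
    (Set.Ioi x).indicator 1 t * (Set.Ioi y).indicator 1 t
      = (Set.Ioi (max x y)).indicator (1 : ℝ → ℝ) t := by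
  simp only [Set.indicator_apply, Set.mem_Ioi, max_lt_iff, Pi.one_apply]
  by_cases h1 : x < t <;> by_cases h2 : y < t <;> simp [h1, h2]

/-- The mean square of the local discrepancy of points of the unit interval. -/
lemma integral_discrepancy_sq (N : ℕ) (x : ℕ → unitInterval) (c : ℝ) :
    ∫ t in (0 : ℝ)..1, (t - c * ∑ n ∈ Finset.range N, (Set.Ioi (x n : ℝ)).indicator 1 t) ^ 2
      = 1 / 3 - c * ∑ n ∈ Finset.range N, (1 - (x n : ℝ) ^ 2)
        + c ^ 2 * ∑ n ∈ Finset.range N, ∑ m ∈ Finset.range N,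
          min (1 - (x n : ℝ)) (1 - (x m : ℝ)) := by
  have hexp : ∀ t : ℝ, (t - c * ∑ n ∈ Finset.range N, (Set.Ioi (x n : ℝ)).indicator 1 t) ^ 2
      = t ^ 2 - 2 * c * ∑ n ∈ Finset.range N, (Set.Ioi (x n : ℝ)).indicator id t
        + c ^ 2 * ∑ n ∈ Finset.range N, ∑ m ∈ Finset.range N,
          (Set.Ioi (max (x n : ℝ) (x m))).indicator (1 : ℝ → ℝ) t := by
    intro t
    have h1 : ∀ n, (Set.Ioi (x n : ℝ)).indicator id t
        = t * (Set.Ioi (x n : ℝ)).indicator (1 : ℝ → ℝ) t := fun n => by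
      simp [Set.indicator_apply]
    simp_rw [← indicator_Ioi_mul_indicator_Ioi, h1, ← Finset.mul_sum, ← Finset.sum_mul]
    ring
  have hid : ∀ n, IntervalIntegrable ((Set.Ioi (x n : ℝ)).indicator id) volume 0 1 := fun n =>
    intervalIntegrable_indicator_Ioi _ continuous_id
  have hone : ∀ y : ℝ, IntervalIntegrable ((Set.Ioi y).indicator (1 : ℝ → ℝ)) volume 0 1 :=
    fun y => intervalIntegrable_indicator_Ioi _ continuous_one
  have hi1 : IntervalIntegrable (fun t => ∑ n ∈ Finset.range N,
      (Set.Ioi (x n : ℝ)).indicator id t) volume 0 1 := by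
    simpa only [Finset.sum_fn] using IntervalIntegrable.sum (Finset.range N) fun n _ => hid n
  have hi2' : ∀ n, IntervalIntegrable (fun t => ∑ m ∈ Finset.range N,
      (Set.Ioi (max (x n : ℝ) (x m))).indicator (1 : ℝ → ℝ) t) volume 0 1 := fun n => by
    simpa only [Finset.sum_fn] using IntervalIntegrable.sum (Finset.range N) fun m _ => hone (max (x n : ℝ) (x m))
  have hi2 : IntervalIntegrable (fun t => ∑ n ∈ Finset.range N, ∑ m ∈ Finset.range N,
      (Set.Ioi (max (x n : ℝ) (x m))).indicator (1 : ℝ → ℝ) t) volume 0 1 := by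
    simpa only [Finset.sum_fn] using IntervalIntegrable.sum (Finset.range N) fun n _ => hi2' n
  have hsq : IntervalIntegrable (fun t : ℝ => t ^ 2) volume 0 1 :=
    (continuous_pow 2).intervalIntegrable _ _
  simp_rw [hexp]
  rw [intervalIntegral.integral_add (hsq.sub (hi1.const_mul _)) (hi2.const_mul _),
    intervalIntegral.integral_sub hsq (hi1.const_mul _), intervalIntegral.integral_const_mul,
    intervalIntegral.integral_const_mul, intervalIntegral.integral_finsetSum fun n _ => hid n,
    intervalIntegral.integral_finsetSum fun n _ => hi2' n]
  have e1 : ∀ n, ∫ t in (0 : ℝ)..1, (Set.Ioi (x n : ℝ)).indicator id t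
      = (1 - (x n : ℝ) ^ 2) / 2 := fun n => by
    rw [integral_indicator_Ioi (x n).2]
    simp [integral_id]
  have e2 : ∀ n, ∫ t in (0 : ℝ)..1, ∑ m ∈ Finset.range N,
      (Set.Ioi (max (x n : ℝ) (x m))).indicator (1 : ℝ → ℝ) t
      = ∑ m ∈ Finset.range N, min (1 - (x n : ℝ)) (1 - (x m : ℝ)) := fun n => by
    rw [intervalIntegral.integral_finsetSum fun m _ => hone _]
    refine Finset.sum_congr rfl fun m _ => ?_
    -- The integral is `1 - max x y`, which is the kernel `min (1 - x) (1 - y)`.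
    rw [integral_indicator_Ioi ⟨le_max_of_le_left (x n).2.1, max_le (x n).2.2 (x m).2.2⟩,
      min_sub_sub_left]
    simp
  simp_rw [e1, e2, ← Finset.sum_div]
  rw [integral_pow]
  norm_num
  ring

/-- Since `min (1 - x) (1 - y)` is the integral of a product of two indicators, the error is an `L²`
discrepancy. The constant part of the kernel drops out because the weights sum to one, hence `1 ≤
N`. -/
lemma worstCaseError_one_sq (γ : ℕ → ℝ≥0) {N : ℕ} (hN : 1 ≤ N) (S : ℕ → UnitCube 1) :
    worstCaseError γ 1 N S ^ 2 = γ 1 * ∫ t in (0 : ℝ)..1,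
      (t - 1 / (N : ℝ) * ∑ n ∈ Finset.range N, (Set.Ioi (S n 0 : ℝ)).indicator 1 t) ^ 2 := by
  have hN' : (N : ℝ) ≠ 0 := by positivity
  rw [integral_discrepancy_sq N fun n => S n 0, worstCaseError_sq]
  simp only [kernelMean, sobolevKernelFun, Fin.prod_univ_one, Finset.sum_add_distrib,
    ← Finset.mul_sum, ← Finset.sum_div]
  simp
  field_simp
  ring

lemma integral_sin_sq_period {N : ℕ} (hN : 1 ≤ N) :
    ∫ t in (0 : ℝ)..1, Real.sin (Real.pi * N * t) ^ 2 = 1 / 2 := by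
  have hN' : (N : ℝ) ≠ 0 := by positivity
  have h : Real.pi * N ≠ 0 := mul_ne_zero Real.pi_ne_zero hN'
  have hs : Real.sin (Real.pi * N) = 0 := by rw [mul_comm]; exact Real.sin_nat_mul_pi N
  rw [intervalIntegral.integral_comp_mul_left (fun u => Real.sin u ^ 2) h, integral_sin_sq]
  simp [hs]
  field_simp

/-- The square of the sine has period `π`, and `|sin u| ≤ |u|`. This bounds the distance to the
integers below by a function whose mean square is explicit. -/
lemma sin_sq_le_sq_sub_nat (x : ℝ) (k : ℕ) :
    Real.sin (Real.pi * x) ^ 2 ≤ Real.pi ^ 2 * (x - k) ^ 2 := by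
  have h : Real.sin (Real.pi * x) ^ 2 = Real.sin (Real.pi * (x - k)) ^ 2 := by
    rw [mul_sub, mul_comm Real.pi (k : ℝ), Real.sin_sub_nat_mul_pi, mul_pow, ← pow_mul, mul_comm k,
      pow_mul]
    simp
  rw [h, ← mul_pow]
  exact sq_le_sq.2 (Real.abs_sin_le_abs)

/-- Every rule with `N` nodes has an error of order at least `1 / N`. -/
lemma worstCaseError_one_sq_ge (γ : ℕ → ℝ≥0) {N : ℕ} (hN : 1 ≤ N) (S : ℕ → UnitCube 1) :
    γ 1 / (2 * Real.pi ^ 2 * (N : ℝ) ^ 2) ≤ worstCaseError γ 1 N S ^ 2 := by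
  have hN' : (0 : ℝ) < N := by positivity
  have hle : ∀ t : ℝ, 1 / (Real.pi ^ 2 * (N : ℝ) ^ 2) * Real.sin (Real.pi * N * t) ^ 2
      ≤ (t - 1 / (N : ℝ) * ∑ n ∈ Finset.range N, (Set.Ioi (S n 0 : ℝ)).indicator 1 t) ^ 2 := by
    intro t
    -- At a fixed `t` the sum counts the nodes below `t`; only its being an integer is used.
    have hk : ∑ n ∈ Finset.range N, (Set.Ioi (S n 0 : ℝ)).indicator (1 : ℝ → ℝ) t
        = (∑ n ∈ Finset.range N, (Set.Ioi (S n 0 : ℝ)).indicator (1 : ℝ → ℕ) t : ℕ) := by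
      push_cast
      refine Finset.sum_congr rfl fun n _ => ?_
      simp only [Set.indicator_apply, Pi.one_apply]
      split_ifs <;> simp
    rw [hk]
    generalize ∑ n ∈ Finset.range N, (Set.Ioi (S n 0 : ℝ)).indicator (1 : ℝ → ℕ) t = k
    have h1 := sin_sq_le_sq_sub_nat (N * t) k
    have h2 : (t - 1 / (N : ℝ) * k) ^ 2
        = 1 / (Real.pi ^ 2 * (N : ℝ) ^ 2) * (Real.pi ^ 2 * (N * t - k) ^ 2) := by
      have := Real.pi_ne_zero
      field_simp
    rw [h2, mul_assoc]
    gcongr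
  have hint : IntervalIntegrable (fun t => (t - 1 / (N : ℝ) *
      ∑ n ∈ Finset.range N, (Set.Ioi (S n 0 : ℝ)).indicator 1 t) ^ 2) volume 0 1 := by
    have hmeas : Measurable fun t : ℝ => (t - 1 / (N : ℝ) *
        ∑ n ∈ Finset.range N, (Set.Ioi (S n 0 : ℝ)).indicator (1 : ℝ → ℝ) t) ^ 2 := by
      have : ∀ n, Measurable ((Set.Ioi (S n 0 : ℝ)).indicator (1 : ℝ → ℝ)) := fun n =>
        measurable_one.indicator measurableSet_Ioi
      fun_prop
    rw [intervalIntegrable_iff_integrableOn_Ioc_of_le zero_le_one]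
    refine Measure.integrableOn_of_bounded (M := 1) (by simp) hmeas.aestronglyMeasurable ?_
    refine (ae_restrict_iff' measurableSet_Ioc).2 (ae_of_all _ fun t ht => ?_)
    have h0 : 0 ≤ ∑ n ∈ Finset.range N, (Set.Ioi (S n 0 : ℝ)).indicator (1 : ℝ → ℝ) t :=
      Finset.sum_nonneg fun n _ => Set.indicator_nonneg (fun _ _ => zero_le_one) _
    have h1 : ∑ n ∈ Finset.range N, (Set.Ioi (S n 0 : ℝ)).indicator (1 : ℝ → ℝ) t ≤ N := by
      refine (Finset.sum_le_sum fun n _ => Set.indicator_le_self' (fun _ _ => zero_le_one) t).trans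
        (by simp)
    rw [Real.norm_of_nonneg (sq_nonneg _), sq_le_one_iff_abs_le_one, abs_le]
    have h2 : 1 / (N : ℝ) * ∑ n ∈ Finset.range N, (Set.Ioi (S n 0 : ℝ)).indicator (1 : ℝ → ℝ) t
        ≤ 1 := by
      rw [one_div, inv_mul_le_iff₀ hN']
      simpa using h1
    have h3 : 0 ≤ 1 / (N : ℝ) *
        ∑ n ∈ Finset.range N, (Set.Ioi (S n 0 : ℝ)).indicator (1 : ℝ → ℝ) t := by positivity
    constructor <;> linarith [ht.1, ht.2]
  have hmono := intervalIntegral.integral_mono_on (zero_le_one' ℝ)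
    ((by fun_prop : Continuous fun t : ℝ => 1 / (Real.pi ^ 2 * (N : ℝ) ^ 2) *
      Real.sin (Real.pi * N * t) ^ 2).intervalIntegrable _ _) hint fun t _ => hle t
  rw [intervalIntegral.integral_const_mul, integral_sin_sq_period hN] at hmono
  rw [worstCaseError_one_sq γ hN]
  refine le_of_eq_of_le ?_ (mul_le_mul_of_nonneg_left hmono (γ 1).coe_nonneg)
  field_simp

/-! ### The rate `1 / N` for a single sequence in any dimension -/

section OpenType

variable (γ : ℕ → ℝ≥0) (s : ℕ)

/-- This is where the open type of the rule enters: one more point changes the unnormalized error by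
the error of a single node. -/
lemma succ_smul_errorVec_sub (N : ℕ) (S : ℕ → UnitCube s) :
    ((N + 1 : ℕ) : ℝ) • errorVec γ s (N + 1) S - (N : ℝ) • errorVec γ s N S
      = meanVec γ s - kernelVec γ s (S N) := by
  have h : ∀ M : ℕ, (M : ℝ) • errorVec γ s M S
      = (M : ℝ) • meanVec γ s - ∑ n ∈ Finset.range M, kernelVec γ s (S n) := by
    intro M
    rcases Nat.eq_zero_or_pos M with rfl | hM
    · simp
    · have hM' : (M : ℝ) ≠ 0 := by positivity
      rw [errorVec, smul_sub, smul_smul, mul_one_div_cancel hM', one_smul]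
  rw [h, h, Finset.sum_range_succ]
  push_cast
  module

/-- The point with first coordinate `a` and the other coordinates equal to those of the anchor. -/
def axisPoint (a : unitInterval) : UnitCube (s + 1) :=
  Fin.cons a fun _ => 1

/-- A coordinate at the anchor contributes the factor `1`, so testing against such kernel functions
reduces the problem to one dimension. -/
lemma sobolevKernelFun_axisPoint (x : UnitCube (s + 1)) (a : unitInterval) :
    sobolevKernelFun γ (s + 1) x (axisPoint s a)
      = 1 + (γ 1 : ℝ) * min (1 - (x 0 : ℝ)) (1 - (a : ℝ)) := by
  have h : ∀ i : Fin s, min (1 - (x i.succ : ℝ)) 0 = 0 := fun i =>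
    min_eq_right (sub_nonneg.2 (x i.succ).2.2)
  simp [sobolevKernelFun, axisPoint, Fin.prod_univ_succ, h]

lemma kernelMean_axisPoint (a : unitInterval) :
    kernelMean γ (s + 1) (axisPoint s a) = 1 + (γ 1 : ℝ) * ((1 - (a : ℝ) ^ 2) / 2) := by
  simp [kernelMean, axisPoint, Fin.prod_univ_succ]

lemma abs_le_norm_meanVec_sub_kernelVec (x : UnitCube (s + 1)) (a : unitInterval) :
    (γ 1 : ℝ) * |(1 - (a : ℝ) ^ 2) / 2 - min (1 - (x 0 : ℝ)) (1 - (a : ℝ))|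
      ≤ ‖meanVec γ (s + 1) - kernelVec γ (s + 1) x‖ * √(1 + γ 1) := by
  have h := abs_real_inner_le_norm (meanVec γ (s + 1) - kernelVec γ (s + 1) x)
    (kernelVec γ (s + 1) (axisPoint s a))
  rw [inner_sub_left, inner_meanVec_kernelVec, inner_kernelVec, kernelMean_axisPoint,
    sobolevKernelFun_axisPoint, add_sub_add_left_eq_sub, ← mul_sub, abs_mul,
    abs_of_nonneg (γ 1).coe_nonneg] at h
  refine h.trans (mul_le_mul_of_nonneg_left (Real.le_sqrt_of_sq_le ?_) (norm_nonneg _))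
  rw [← real_inner_self_eq_norm_sq, inner_kernelVec, sobolevKernelFun_axisPoint]
  have := mul_le_of_le_one_right (γ 1).coe_nonneg
    ((min_le_right _ _).trans (by linarith [a.2.1]) :
      min (1 - (axisPoint s a 0 : ℝ)) (1 - (a : ℝ)) ≤ 1)
  simpa using this

lemma le_norm_meanVec_sub_kernelVec (x : UnitCube (s + 1)) :
    (γ 1 : ℝ) / (16 * √(1 + γ 1)) ≤ ‖meanVec γ (s + 1) - kernelVec γ (s + 1) x‖ := by
  have h0 := abs_le_norm_meanVec_sub_kernelVec γ s x 0
  have h1 := abs_le_norm_meanVec_sub_kernelVec γ s x ⟨1 / 2, by norm_num, by norm_num⟩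
  have hpos : 0 < √(1 + (γ 1 : ℝ)) := Real.sqrt_pos.2 (by positivity)
  -- One node cannot integrate both test functions exactly: `a = 0` forces `1 - x 0 = 1 / 2`, while
  -- for `a = 1 / 2` this value misses the mean `3 / 8` by `1 / 8`.
  have key : (1 : ℝ) / 8 ≤ |(1 - ((0 : unitInterval) : ℝ) ^ 2) / 2
      - min (1 - (x 0 : ℝ)) (1 - ((0 : unitInterval) : ℝ))|
      + |(1 - (1 / 2 : ℝ) ^ 2) / 2 - min (1 - (x 0 : ℝ)) (1 - 1 / 2)| := by
    have hx := (x 0).2.1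
    rw [Set.Icc.coe_zero, min_eq_left (by linarith)]
    rcases le_total (1 - (x 0 : ℝ)) (1 - 1 / 2) with h | h
    · rw [min_eq_left h]
      have a1 := neg_abs_le ((1 - (0 : ℝ) ^ 2) / 2 - (1 - (x 0 : ℝ)))
      have a2 := le_abs_self ((1 - (0 : ℝ) ^ 2) / 2 - (1 - (x 0 : ℝ)))
      have a3 := neg_abs_le ((1 - (1 / 2 : ℝ) ^ 2) / 2 - (1 - (x 0 : ℝ)))
      linarith
    · rw [min_eq_right h]
      have a1 := abs_nonneg ((1 - (0 : ℝ) ^ 2) / 2 - (1 - (x 0 : ℝ)))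
      have a3 := neg_abs_le ((1 - (1 / 2 : ℝ) ^ 2) / 2 - (1 - (1 / 2 : ℝ)))
      linarith
  have h2 := mul_le_mul_of_nonneg_left key (γ 1).coe_nonneg
  rw [mul_add] at h2
  rw [div_le_iff₀ (by positivity)]
  linarith

/-- No sequence has worst-case errors of order smaller than `1 / N`. -/
lemma not_isLittleO_worstCaseError (hγ : 0 < γ 1) (S : ℕ → UnitCube (s + 1)) :
    ¬ Asymptotics.IsLittleO Filter.atTop
      (fun N : ℕ => worstCaseError γ (s + 1) N S) (fun N : ℕ => 1 / (N : ℝ)) := by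
  intro h
  have hγ' : (0 : ℝ) < γ 1 := hγ
  set c : ℝ := (γ 1 : ℝ) / (16 * √(1 + γ 1)) with hc
  have hcpos : 0 < c := by positivity
  -- Two consecutive errors of at most `c / 4` each add up to `c / 2`, less than the lower bound `c`
  -- for their difference.
  obtain ⟨N₀, hN₀⟩ := Filter.eventually_atTop.1 (h.bound (show 0 < c / 4 by positivity))
  have hb : ∀ N : ℕ, N₀ + 1 ≤ N → N * ‖errorVec γ (s + 1) N S‖ ≤ c / 4 := by
    intro N hN
    have hNpos : (0 : ℝ) < N := by exact_mod_cast (by lia : 0 < N)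
    have := hN₀ N (by lia)
    rw [worstCaseError_eq_norm, norm_norm, Real.norm_of_nonneg (by positivity)] at this
    calc N * ‖errorVec γ (s + 1) N S‖ ≤ N * (c / 4 * (1 / N)) := by gcongr
      _ = c / 4 := by field_simp
  have h1 := hb (N₀ + 1) le_rfl
  have h2 := hb (N₀ + 1 + 1) (by lia)
  have h3 := le_norm_meanVec_sub_kernelVec γ s (S (N₀ + 1))
  rw [← succ_smul_errorVec_sub] at h3
  have h4 := norm_sub_le (((N₀ + 1 + 1 : ℕ) : ℝ) • errorVec γ (s + 1) (N₀ + 1 + 1) S)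
    (((N₀ + 1 : ℕ) : ℝ) • errorVec γ (s + 1) (N₀ + 1) S)
  rw [norm_smul, norm_smul, Real.norm_of_nonneg (by positivity),
    Real.norm_of_nonneg (by positivity)] at h4
  linarith

end OpenType

/-! ### Sums of periodic functions on the integers -/

section Periodic

lemma sum_range_mul (f : ℕ → ℝ) (b a : ℕ) :
    ∑ k ∈ Finset.range (b * a), f k
      = ∑ t ∈ Finset.range a, ∑ i ∈ Finset.range b, f (i + b * t) := by
  induction a with
  | zero => simp
  | succ a ih =>
    rw [Nat.mul_succ, Finset.sum_range_add, ih, Finset.sum_range_succ]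
    simp_rw [add_comm (b * a)]

variable {F : ℤ → ℝ} {M : ℕ}

lemma sum_range_periodic_add (hF : Function.Periodic F M) (c : ℤ) :
    ∑ a ∈ Finset.range M, F (a + c) = ∑ a ∈ Finset.range M, F a := by
  have step : ∀ c : ℤ,
      ∑ a ∈ Finset.range M, F (a + (c + 1)) = ∑ a ∈ Finset.range M, F (a + c) := by
    intro c
    have h1 := Finset.sum_range_succ (fun a : ℕ => F (a + c)) M
    rw [Finset.sum_range_succ', add_comm (M : ℤ) c, hF c] at h1
    simp only [Nat.cast_zero, zero_add, add_left_inj] at h1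
    rw [← h1]
    refine Finset.sum_congr rfl fun a _ => ?_
    congr 1
    push_cast
    ring
  induction c using Int.induction_on with
  | zero => simp
  | succ i ih => rw [step, ih]
  | pred i ih => rw [← ih, ← step, sub_add_cancel]

lemma sum_range_periodic_sub (hF : Function.Periodic F M) (c : ℤ) :
    ∑ a ∈ Finset.range M, F (c - a) = ∑ a ∈ Finset.range M, F a := by
  rw [← Finset.sum_range_reflect, ← sum_range_periodic_add hF (c - M + 1)]
  refine Finset.sum_congr rfl fun a ha => ?_
  have := Finset.mem_range.1 ha
  congr 1
  rw [Nat.cast_sub (by lia), Nat.cast_sub (by lia)]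
  push_cast
  ring

/-- Complete periods contribute zero. -/
lemma sum_range_eq_sum_range_mod (hF : Function.Periodic F M)
    (h0 : ∑ a ∈ Finset.range M, F a = 0) (N : ℕ) :
    ∑ n ∈ Finset.range N, F n = ∑ n ∈ Finset.range (N % M), F n := by
  have hshift : ∀ (i : ℤ) (t : ℕ), F (i + M * t) = F i := fun i t => by
    rw [mul_comm]
    exact hF.nat_mul t i
  conv_lhs => rw [← Nat.div_add_mod N M, Finset.sum_range_add, sum_range_mul (fun n : ℕ => F n)]
  have h1 : ∀ t : ℕ, ∑ i ∈ Finset.range M, F ((i + M * t : ℕ) : ℤ) = 0 := fun t => by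
    rw [← h0]
    refine Finset.sum_congr rfl fun i _ => ?_
    push_cast
    exact hshift i t
  rw [Finset.sum_eq_zero fun t _ => h1 t, zero_add]
  refine Finset.sum_congr rfl fun i _ => ?_
  push_cast
  rw [add_comm]
  exact_mod_cast hshift i (N / M)

/-- Autocorrelation sums of a periodic function of mean zero. -/
lemma abs_sum_sum_sub_le (hF : Function.Periodic F M)
    (h0 : ∑ a ∈ Finset.range M, F a = 0) (hM : 0 < M) (N : ℕ) :
    |∑ n ∈ Finset.range N, ∑ m ∈ Finset.range N, F (n - m)|
      ≤ (N % M : ℕ) * ∑ k ∈ Finset.range M, |F k| := by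
  have h1 : ∀ m : ℕ, ∑ n ∈ Finset.range N, F (n - m)
      = ∑ n ∈ Finset.range (N % M), F (n - m) := fun m => by
    have hp : Function.Periodic (fun n : ℤ => F (n - m)) M := fun n => by
      simp only [add_sub_right_comm, hF (n - m)]
    refine sum_range_eq_sum_range_mod hp ?_ N
    simpa [sub_eq_add_neg, h0] using sum_range_periodic_add hF (-(m : ℤ))
  have h2 : ∀ n : ℕ, ∑ m ∈ Finset.range N, F (n - m)
      = ∑ m ∈ Finset.range (N % M), F (n - m) := fun n => by
    have hp : Function.Periodic (fun m : ℤ => F (n - m)) M := fun m => by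
      simp only [← sub_sub, hF.sub_eq]
    exact sum_range_eq_sum_range_mod hp ((sum_range_periodic_sub hF n).trans h0) N
  have habs : Function.Periodic (fun k => |F k|) M := fun k => by simp only [hF k]
  -- Full periods are removed in both variables. Each remaining row is then extended to a full
  -- period of `|F|`.
  rw [Finset.sum_comm, Finset.sum_congr rfl fun m _ => h1 m, Finset.sum_comm,
    Finset.sum_congr rfl fun n _ => h2 n]
  refine (Finset.abs_sum_le_sum_abs _ _).trans ((Finset.sum_le_card_nsmul _ _
    (∑ k ∈ Finset.range M, |F k|) fun n _ => ?_).trans_eq (by simp))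
  refine (Finset.abs_sum_le_sum_abs _ _).trans ?_
  rw [← sum_range_periodic_sub habs n]
  exact Finset.sum_le_sum_of_subset_of_nonneg
    (Finset.range_mono (Nat.mod_lt _ hM).le) fun _ _ _ => abs_nonneg _

/-- The map `t ↦ i + b * t` permutes the residues modulo `M`. -/
lemma sum_range_add_mul_of_coprime {b : ℕ} (hF : Function.Periodic F M) (h : Nat.Coprime M b)
    (i : ℕ) : ∑ t ∈ Finset.range M, F ((i + b * t : ℕ) : ℤ) = ∑ t ∈ Finset.range M, F t := by
  have hmod : ∀ n : ℕ, F ((n % M : ℕ) : ℤ) = F n := fun n => by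
    conv_rhs => rw [← Nat.mod_add_div n M]
    push_cast
    rw [mul_comm]
    exact (hF.nat_mul (n / M) _).symm
  have hinj : Set.InjOn (fun t => (i + b * t) % M) (Finset.range M) := by
    intro t ht u hu htu
    have h1 : i + b * t ≡ i + b * u [MOD M] := htu
    have h2 := Nat.ModEq.cancel_left_of_coprime h (Nat.ModEq.add_left_cancel' i h1)
    exact Nat.ModEq.eq_of_lt_of_lt h2 (by simpa using ht) (by simpa using hu)
  have himg : (Finset.range M).image (fun t => (i + b * t) % M) = Finset.range M := by
    refine Finset.eq_of_subset_of_card_le (fun x hx => ?_) (Finset.card_image_of_injOn hinj).ge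
    obtain ⟨t, ht, rfl⟩ := Finset.mem_image.1 hx
    exact Finset.mem_range.2 (Nat.mod_lt _ (by simp at ht; lia))
  calc ∑ t ∈ Finset.range M, F ((i + b * t : ℕ) : ℤ)
      = ∑ t ∈ Finset.range M, F (((i + b * t) % M : ℕ) : ℤ) := by simp_rw [hmod]
    _ = ∑ x ∈ (Finset.range M).image (fun t => (i + b * t) % M), F (x : ℤ) :=
      (Finset.sum_image (f := fun x : ℕ => F x) hinj).symm
    _ = _ := by rw [himg]

lemma sum_range_mul_of_coprime {f g : ℤ → ℝ} {a b : ℕ} (hf : Function.Periodic f a)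
    (hg : Function.Periodic g b) (h : Nat.Coprime a b) :
    ∑ k ∈ Finset.range (a * b), f k * g k
      = (∑ t ∈ Finset.range a, f t) * ∑ i ∈ Finset.range b, g i := by
  rw [mul_comm a b, sum_range_mul (fun k : ℕ => f k * g k), Finset.sum_comm, mul_comm,
    Finset.sum_mul]
  refine Finset.sum_congr rfl fun i _ => ?_
  rw [← sum_range_add_mul_of_coprime hf h i, Finset.mul_sum]
  refine Finset.sum_congr rfl fun t _ => ?_
  rw [mul_comm]
  congr 1
  push_cast
  rw [mul_comm (b : ℤ)]
  exact_mod_cast hg.nat_mul t i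

lemma periodic_prod {ι : Type*} (s : Finset ι) {P : ι → ℕ} {f : ι → ℤ → ℝ}
    (hf : ∀ i, Function.Periodic (f i) (P i)) :
    Function.Periodic (fun k => ∏ i ∈ s, f i k) ((∏ i ∈ s, P i : ℕ) : ℤ) := fun k =>
  Finset.prod_congr rfl fun i hi => by
    obtain ⟨c, hc⟩ := Finset.dvd_prod_of_mem P hi
    rw [hc, mul_comm]
    push_cast
    exact (hf i).nat_mul c k

/-- The Chinese remainder theorem for sums of products. -/
lemma sum_range_prod {ι : Type*} (s : Finset ι) {P : ι → ℕ} {f : ι → ℤ → ℝ}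
    (hf : ∀ i, Function.Periodic (f i) (P i)) (hP : Pairwise fun i j => Nat.Coprime (P i) (P j)) :
    ∑ k ∈ Finset.range (∏ i ∈ s, P i), ∏ i ∈ s, f i k
      = ∏ i ∈ s, ∑ k ∈ Finset.range (P i), f i k := by
  classical
  induction s using Finset.induction_on with
  | empty => simp
  | insert i s hi ih =>
    simp only [Finset.prod_insert hi]
    rw [← ih]
    refine sum_range_mul_of_coprime (hf i) (periodic_prod s hf) (Nat.Coprime.prod_right fun j hj => ?_)
    exact hP (ne_of_mem_of_not_mem hj hi).symm

end Periodic

/-! ### Truncated radical inverses -/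

section Digits

variable (p : ℕ)

/-- The radical inverse of the first `G` digits in base `p` of an integer. -/
noncomputable def truncRadicalInverse (G : ℕ) (a : ℤ) : ℝ :=
  ∑ r ∈ Finset.range G, ((a / (p : ℤ) ^ r % p : ℤ) : ℝ) * ((p : ℝ) ^ (r + 1))⁻¹

lemma truncRadicalInverse_periodic (hp : 0 < p) (G : ℕ) :
    Function.Periodic (truncRadicalInverse p G) ((p ^ G : ℕ) : ℤ) := by
  intro a
  refine Finset.sum_congr rfl fun r hr => ?_
  have hr := Finset.mem_range.1 hr
  obtain ⟨c, rfl⟩ := Nat.exists_eq_add_of_lt hr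
  have hpr : ((p : ℤ) ^ r) ≠ 0 := by positivity
  have : a + ((p ^ (r + c + 1) : ℕ) : ℤ) = a + (p : ℤ) ^ r * (p * p ^ c) := by
    push_cast
    ring
  rw [this, Int.add_mul_ediv_left _ _ hpr, Int.add_mul_emod_self_left]

/-- The lowest digit becomes the leading one. This self-similarity drives the inductions on the
number of digits. -/
lemma truncRadicalInverse_succ {d : ℤ} (h0 : 0 ≤ d) (hd : d < p) (G : ℕ) (a : ℤ) :
    truncRadicalInverse p (G + 1) (d + p * a) = (d + truncRadicalInverse p G a) / p := by
  have hp : (p : ℤ) ≠ 0 := by lia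
  have hp' : (p : ℝ) ≠ 0 := by exact_mod_cast hp
  rw [truncRadicalInverse, truncRadicalInverse, Finset.sum_range_succ', add_comm, add_div,
    Finset.sum_div]
  congr 1
  · simp [Int.emod_eq_of_lt h0 hd, div_eq_mul_inv]
  · refine Finset.sum_congr rfl fun r _ => ?_
    have : (d + p * a) / (p : ℤ) ^ (r + 1) = a / (p : ℤ) ^ r := by
      rw [pow_succ', ← Int.ediv_ediv_of_nonneg (by lia), Int.add_mul_ediv_left _ _ hp,
        Int.ediv_eq_zero_of_lt h0 hd, zero_add]
    rw [this]
    field_simp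
    ring

lemma truncRadicalInverse_nonneg (hp : 0 < p) (G : ℕ) (a : ℤ) : 0 ≤ truncRadicalInverse p G a :=
  Finset.sum_nonneg fun r _ => mul_nonneg
    (by exact_mod_cast Int.emod_nonneg _ (by lia)) (by positivity)

lemma truncRadicalInverse_le_one (hp : 0 < p) (G : ℕ) (a : ℤ) :
    truncRadicalInverse p G a ≤ 1 := by
  induction G generalizing a with
  | zero => simp [truncRadicalInverse]
  | succ G ih =>
    have h1 : a % (p : ℤ) < p := Int.emod_lt_of_pos _ (by lia)
    rw [← Int.emod_add_mul_ediv a p,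
      truncRadicalInverse_succ p (Int.emod_nonneg _ (by lia)) h1, div_le_one (by positivity)]
    have h2 : ((a % (p : ℤ) : ℤ) : ℝ) + 1 ≤ p := by exact_mod_cast h1
    linarith [ih (a / p)]

/-- The mean zero part of the kernel of a shifted radical inverse at the first digit. -/
noncomputable def digitKernel (u : ℤ) : ℝ :=
  if (p : ℤ) ∣ u then ((p : ℝ) - 1) / (6 * p)
  else 1 / 6 - ((u % p : ℤ) : ℝ) * (p - (u % p : ℤ)) / (p : ℝ) ^ 2

/-- The contribution of digit `g` to the kernel of a shifted radical inverse. -/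
noncomputable def levelKernel (g : ℕ) (k : ℤ) : ℝ :=
  if (p : ℤ) ^ g ∣ k then ((p : ℝ) ^ g)⁻¹ * digitKernel p (k / (p : ℤ) ^ g) else 0

lemma digitKernel_periodic : Function.Periodic (digitKernel p) p := fun u => by
  simp [digitKernel]

lemma levelKernel_periodic (hp : 0 < p) (g : ℕ) :
    Function.Periodic (levelKernel p g) ((p ^ (g + 1) : ℕ) : ℤ) := fun k => by
  have h : k + ((p ^ (g + 1) : ℕ) : ℤ) = k + (p : ℤ) ^ g * p := by push_cast; ring
  have hpg : ((p : ℤ) ^ g) ≠ 0 := by positivity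
  rw [levelKernel, levelKernel, h, Int.add_mul_ediv_left _ _ hpg, digitKernel_periodic]
  simp [Int.dvd_add_left (Dvd.intro _ rfl)]

lemma levelKernel_zero (k : ℤ) : levelKernel p 0 k = digitKernel p k := by
  simp [levelKernel]

lemma levelKernel_succ_mul (hp : 0 < p) (g : ℕ) (k : ℤ) :
    levelKernel p (g + 1) (p * k) = levelKernel p g k / p := by
  have hp' : (p : ℤ) ≠ 0 := by lia
  have hp'' : (p : ℝ) ≠ 0 := by positivity
  simp only [levelKernel, pow_succ', mul_dvd_mul_iff_left hp', Int.mul_ediv_mul_of_pos k _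
    (by lia : (0 : ℤ) < p)]
  split_ifs
  · field_simp
  · simp

lemma levelKernel_succ_of_not_dvd (g : ℕ) {k : ℤ} (hk : ¬ (p : ℤ) ∣ k) :
    levelKernel p (g + 1) k = 0 :=
  if_neg fun h => hk ((dvd_pow_self _ (Nat.succ_ne_zero g)).trans h)

/-- Only multiples of `p ^ g` contribute, one for each value of digit `g`. The function `φ` is the
identity for the mean and the absolute value for the `L¹` norm. -/
lemma sum_levelKernel_period (hp : 0 < p) (g : ℕ) (φ : ℝ → ℝ) (h0 : φ 0 = 0) :
    ∑ k ∈ Finset.range (p ^ (g + 1)), φ (levelKernel p g k)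
      = ∑ u ∈ Finset.range p, φ (((p : ℝ) ^ g)⁻¹ * digitKernel p u) := by
  rw [pow_succ, sum_range_mul (fun k : ℕ => φ (levelKernel p g k))]
  refine Finset.sum_congr rfl fun u _ => ?_
  have hpg : 0 < p ^ g := by positivity
  rw [Finset.sum_eq_single_of_mem 0 (Finset.mem_range.2 hpg)]
  · have hpg' : ((p : ℤ) ^ g) ≠ 0 := by positivity
    simp [levelKernel, hpg']
  · intro i hi hi0
    have hi := Finset.mem_range.1 hi
    rw [levelKernel, if_neg, h0]
    intro h
    push_cast at h
    rw [Int.dvd_add_left (Dvd.intro _ rfl)] at h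
    have h' : p ^ g ∣ i := by exact_mod_cast h
    exact hi0 (Nat.eq_zero_of_dvd_of_lt h' hi)

lemma digitKernel_natCast {u : ℕ} (hu : u < p) (h0 : u ≠ 0) :
    digitKernel p u = 1 / 6 - (u : ℝ) * (p - u) / (p : ℝ) ^ 2 := by
  have h1 : ¬ (p : ℤ) ∣ u := fun h =>
    h0 (Nat.eq_zero_of_dvd_of_lt (by exact_mod_cast h) hu)
  have h2 : ((u : ℤ) % p) = u := by exact_mod_cast Nat.mod_eq_of_lt hu
  rw [digitKernel, if_neg h1, h2]
  simp

lemma sum_digitKernel (hp : 0 < p) : ∑ u ∈ Finset.range p, digitKernel p u = 0 := by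
  have hsum : ∀ n : ℕ, ∑ u ∈ Finset.range n, (1 / 6 - (u : ℝ) * (p - u) / (p : ℝ) ^ 2)
      = n / 6 - ((p : ℝ) * (n * (n - 1) / 2) - n * (n - 1) * (2 * n - 1) / 6) / (p : ℝ) ^ 2 := by
    intro n
    induction n with
    | zero => simp
    | succ n ih =>
      rw [Finset.sum_range_succ, ih]
      push_cast
      ring
  have hp' : (p : ℝ) ≠ 0 := by positivity
  -- The value at `0` lies `1 / (6 * p)` below that of the formula for `u ≠ 0`; this correction
  -- makes the mean vanish.
  have h : ∀ u ∈ Finset.range p, digitKernel p u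
      = (1 / 6 - (u : ℝ) * (p - u) / (p : ℝ) ^ 2) - if u = 0 then 1 / (6 * (p : ℝ)) else 0 := by
    intro u hu
    split_ifs with h0
    · subst h0
      simp [digitKernel]
      field_simp
    · rw [digitKernel_natCast p (Finset.mem_range.1 hu) h0, sub_zero]
  rw [Finset.sum_congr rfl h, Finset.sum_sub_distrib, hsum, Finset.sum_ite_eq',
    if_pos (Finset.mem_range.2 hp)]
  field_simp
  ring

lemma abs_digitKernel_le {u : ℕ} (hu : u < p) : |digitKernel p u| ≤ 1 / 6 := by
  have hp : (1 : ℝ) ≤ p := by exact_mod_cast (by lia : 1 ≤ p)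
  rcases eq_or_ne u 0 with rfl | h0
  · simp only [digitKernel, Nat.cast_zero, dvd_zero, if_true]
    rw [abs_of_nonneg (div_nonneg (by linarith) (by positivity)), div_le_iff₀ (by positivity)]
    linarith
  · rw [digitKernel_natCast p hu h0]
    have hu' : (u : ℝ) ≤ p := by exact_mod_cast hu.le
    have h1 : 0 ≤ (u : ℝ) * (p - u) / (p : ℝ) ^ 2 :=
      div_nonneg (mul_nonneg (by positivity) (by linarith)) (by positivity)
    have h2 : (u : ℝ) * (p - u) / (p : ℝ) ^ 2 ≤ 1 / 4 := by
      rw [div_le_iff₀ (by positivity)]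
      nlinarith [sq_nonneg ((p : ℝ) - 2 * u)]
    rw [abs_le]
    constructor <;> linarith

lemma sum_levelKernel (hp : 0 < p) (g : ℕ) :
    ∑ k ∈ Finset.range (p ^ (g + 1)), levelKernel p g k = 0 := by
  refine (sum_levelKernel_period p hp g id rfl).trans ?_
  simp only [id, ← Finset.mul_sum, sum_digitKernel p hp, mul_zero]

lemma sum_abs_levelKernel_le (hp : 0 < p) (g : ℕ) :
    ∑ k ∈ Finset.range (p ^ (g + 1)), |levelKernel p g k|
      ≤ (p : ℝ) ^ 2 / 6 * ((p : ℝ) ^ (g + 1))⁻¹ := by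
  rw [sum_levelKernel_period p hp g abs abs_zero]
  have hp' : (p : ℝ) ≠ 0 := by positivity
  refine (Finset.sum_le_card_nsmul _ _ (((p : ℝ) ^ g)⁻¹ * (1 / 6)) fun u hu => ?_).trans_eq ?_
  · rw [abs_mul, abs_of_nonneg (by positivity)]
    gcongr
    exact abs_digitKernel_le p (Finset.mem_range.1 hu)
  · simp
    field_simp
    ring

/-- The mean absolute difference of two shifted truncated radical inverses at distance `k`. -/
noncomputable def meanAbsDiff (G : ℕ) (k : ℤ) : ℝ :=
  ((p : ℝ) ^ G)⁻¹ * ∑ a ∈ Finset.range (p ^ G),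
    |truncRadicalInverse p G (a + k) - truncRadicalInverse p G a|

lemma meanAbsDiff_succ (G : ℕ) (k : ℤ) :
    meanAbsDiff p (G + 1) k = (p : ℝ)⁻¹ * ∑ d ∈ Finset.range p, ((p : ℝ) ^ G)⁻¹ *
      ∑ a ∈ Finset.range (p ^ G), |truncRadicalInverse p (G + 1) (d + p * a + k)
        - truncRadicalInverse p (G + 1) (d + p * a)| := by
  rw [meanAbsDiff, pow_succ' p G, sum_range_mul (fun a : ℕ =>
    |truncRadicalInverse p (G + 1) (a + k) - truncRadicalInverse p (G + 1) a|), Finset.sum_comm,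
    pow_succ', mul_inv, ← Finset.mul_sum, mul_assoc]
  push_cast
  rfl

lemma meanAbsDiff_succ_mul (hp : 0 < p) (G : ℕ) (k : ℤ) :
    meanAbsDiff p (G + 1) (p * k) = meanAbsDiff p G k / p := by
  have hp' : (p : ℝ) ≠ 0 := by positivity
  have h : ∀ d ∈ Finset.range p, ((p : ℝ) ^ G)⁻¹ *
      ∑ a ∈ Finset.range (p ^ G), |truncRadicalInverse p (G + 1) (d + p * a + p * k)
        - truncRadicalInverse p (G + 1) (d + p * a)| = meanAbsDiff p G k / p := by
    intro d hd
    have hd' : (d : ℤ) < p := by exact_mod_cast Finset.mem_range.1 hd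
    rw [meanAbsDiff, mul_div_assoc, Finset.sum_div]
    congr 1
    refine Finset.sum_congr rfl fun a _ => ?_
    rw [add_assoc, ← mul_add, truncRadicalInverse_succ p (by lia) hd',
      truncRadicalInverse_succ p (by lia) hd', ← sub_div, add_sub_add_left_eq_sub, abs_div,
      Nat.abs_cast]
  rw [meanAbsDiff_succ, Finset.sum_congr rfl h]
  simp
  field_simp

/-- Translation by `k` permutes the residues modulo `p ^ G`, so the two averages cancel. -/
lemma average_add_truncRadicalInverse_sub (hp : 0 < p) (G : ℕ) (k : ℤ) (c : ℝ) :
    ((p : ℝ) ^ G)⁻¹ * ∑ a ∈ Finset.range (p ^ G),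
      (c + (truncRadicalInverse p G (a + k) - truncRadicalInverse p G a)) = c := by
  rw [Finset.sum_add_distrib, Finset.sum_sub_distrib,
    sum_range_periodic_add (truncRadicalInverse_periodic p hp G)]
  have : (p : ℝ) ^ G ≠ 0 := by positivity
  simp
  field_simp

/-- The leading digits differ by `u` for `p - u` values of `d` and, after a carry, by `u - p` for
the other `u` values. As the tails lie in `[0, 1]`, the leading digits fix the sign of the
difference; the absolute value opens and the tails average out. Both cases contribute `u * (p - u) /
p ^ 2`. -/
lemma meanAbsDiff_succ_of_pos (hp : 0 < p) (G : ℕ) {u : ℕ} (hu0 : 0 < u) (hu : u < p) (k : ℤ) :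
    meanAbsDiff p (G + 1) (u + p * k) = 2 * (u * (p - u) / (p : ℝ) ^ 2) := by
  have hp' : (p : ℝ) ≠ 0 := by positivity
  have h0 := truncRadicalInverse_nonneg p hp G
  have h1 := truncRadicalInverse_le_one p hp G
  have hu0' : (1 : ℝ) ≤ u := by exact_mod_cast hu0
  have hu' : (u : ℝ) + 1 ≤ p := by exact_mod_cast hu
  have ha : ∀ d ∈ Finset.range (p - u), ((p : ℝ) ^ G)⁻¹ *
      ∑ a ∈ Finset.range (p ^ G), |truncRadicalInverse p (G + 1) (d + p * a + (u + p * k))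
        - truncRadicalInverse p (G + 1) (d + p * a)| = u / p := by
    intro d hd
    have hd := Finset.mem_range.1 hd
    refine Eq.trans ?_ (average_add_truncRadicalInverse_sub p hp G k (u / p * p) |>.symm ▸
      (by field_simp : (u / p * p : ℝ) / p = u / p))
    rw [mul_div_assoc, Finset.sum_div]
    congr 1
    refine Finset.sum_congr rfl fun a _ => ?_
    rw [show (d : ℤ) + p * a + (u + p * k) = ((d + u : ℕ) : ℤ) + p * (a + k) by push_cast; ring,
      truncRadicalInverse_succ p (by lia) (by lia), truncRadicalInverse_succ p (by lia) (by lia),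
      ← sub_div, abs_div, Nat.abs_cast, div_mul_cancel₀ _ hp']
    congr 1
    push_cast
    rw [abs_of_nonneg (by linarith [h0 (a + k), h1 a])]
    ring
  have hb : ∀ d ∈ Finset.range u, ((p : ℝ) ^ G)⁻¹ *
      ∑ a ∈ Finset.range (p ^ G), |truncRadicalInverse p (G + 1) ((p - u + d : ℕ) + p * a +
        (u + p * k)) - truncRadicalInverse p (G + 1) ((p - u + d : ℕ) + p * a)| = (p - u) / p := by
    intro d hd
    have hd := Finset.mem_range.1 hd
    have e : ((p - u + d : ℕ) : ℤ) = p - u + d := by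
      push_cast [Nat.cast_sub hu.le]
      ring
    refine Eq.trans ?_ (congrArg (fun x : ℝ => -(x / p))
      (average_add_truncRadicalInverse_sub p hp G (k + 1) (u - p)) |>.trans
      (by field_simp; ring : -(((u : ℝ) - p) / p) = (p - u) / p))
    rw [mul_div_assoc, Finset.sum_div, ← mul_neg, ← Finset.sum_neg_distrib]
    congr 1
    refine Finset.sum_congr rfl fun a _ => ?_
    -- The carry out of the lowest digit turns `k` into `k + 1`.
    rw [e, show (p : ℤ) - u + d + p * a + (u + p * k) = (d : ℤ) + p * (a + (k + 1)) by ring,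
      truncRadicalInverse_succ p (by lia) (by lia), truncRadicalInverse_succ p (by lia) (by lia),
      ← sub_div, abs_div, Nat.abs_cast, ← neg_div]
    congr 1
    push_cast
    rw [abs_of_nonpos (by linarith [h0 a, h1 (a + (k + 1))])]
    ring
  have hsplit : Finset.range p = Finset.range (p - u + u) := by rw [Nat.sub_add_cancel hu.le]
  rw [meanAbsDiff_succ, hsplit, Finset.sum_range_add, Finset.sum_congr rfl ha,
    Finset.sum_congr rfl hb]
  simp [Nat.cast_sub hu.le]
  field_simp
  ring

/-- The levels of the kernel add up to the kernel of the truncated radical inverse. -/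
lemma sum_levelKernel_eq (hp : 0 < p) (G : ℕ) (k : ℤ) :
    ∑ g ∈ Finset.range G, levelKernel p g k = 1 / 6 - meanAbsDiff p G k / 2
      - if (p : ℤ) ^ G ∣ k then ((p : ℝ) ^ G)⁻¹ / 6 else 0 := by
  have hp' : (p : ℝ) ≠ 0 := by positivity
  have hpz : (p : ℤ) ≠ 0 := by lia
  induction G generalizing k with
  | zero => simp [meanAbsDiff, truncRadicalInverse]
  | succ G ih =>
    rw [Finset.sum_range_succ', levelKernel_zero]
    -- If `p` divides `k`, everything beyond level `0` scales by `1 / p`, and `1 / 6 = (1 / 6) / p +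
    -- (p - 1) / (6 * p)`. Otherwise only level `0` is nonzero.
    by_cases hk : (p : ℤ) ∣ k
    · obtain ⟨k, rfl⟩ := hk
      rw [Finset.sum_congr rfl fun g _ => levelKernel_succ_mul p hp g k, ← Finset.sum_div, ih,
        meanAbsDiff_succ_mul p hp, digitKernel, if_pos (Dvd.intro _ rfl)]
      simp only [pow_succ', mul_dvd_mul_iff_left hpz]
      split_ifs
      · field_simp
        ring
      · field_simp
        ring
    · rw [Finset.sum_eq_zero fun g _ => levelKernel_succ_of_not_dvd p g hk, zero_add,
        if_neg fun h => hk ((dvd_pow_self _ (Nat.succ_ne_zero G)).trans h), sub_zero, digitKernel,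
        if_neg hk]
      have h1 : 0 ≤ k % (p : ℤ) := Int.emod_nonneg _ hpz
      have h2 : k % (p : ℤ) < p := Int.emod_lt_of_pos _ (by lia)
      have h3 : k % (p : ℤ) ≠ 0 := fun h => hk (Int.dvd_of_emod_eq_zero h)
      obtain ⟨u, hu⟩ := Int.eq_ofNat_of_zero_le h1
      have hku : k = u + p * (k / p) := by
        rw [← hu]
        exact (Int.emod_add_mul_ediv k p).symm
      rw [hu] at h2 h3 ⊢
      conv_rhs => rw [hku, meanAbsDiff_succ_of_pos p hp G (u := u) (by lia) (by lia)]
      simp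

end Digits

/-! ### Sums of the shift-averaged kernel -/

/-- The terms in the expansion of a factor of the shift-averaged kernel. -/
noncomputable def levelFactor (p : ℕ) (c : ℝ) : ℕ → ℤ → ℝ
  | 0, _ => 1 + c / 3
  | g + 1, k => c * levelKernel p g k

/-- The mean absolute values of the terms `levelFactor`, up to the length of the period. -/
noncomputable def levelWeight (p : ℕ) (c : ℝ) : ℕ → ℝ
  | 0 => 1 + c / 3
  | _ + 1 => c * ((p : ℝ) ^ 2 / 6)

lemma levelWeight_nonneg (p : ℕ) {c : ℝ} (hc : 0 ≤ c) (l : ℕ) : 0 ≤ levelWeight p c l := by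
  cases l <;> simp only [levelWeight] <;> positivity

lemma levelFactor_periodic {p : ℕ} (hp : 0 < p) (c : ℝ) (l : ℕ) :
    Function.Periodic (levelFactor p c l) ((p ^ l : ℕ) : ℤ) := fun k => by
  cases l with
  | zero => rfl
  | succ g => simp only [levelFactor, levelKernel_periodic p hp g k]

lemma sum_abs_levelFactor_le {p : ℕ} (hp : 0 < p) {c : ℝ} (hc : 0 ≤ c) (l : ℕ) :
    ∑ k ∈ Finset.range (p ^ l), |levelFactor p c l k|
      ≤ levelWeight p c l * ((p : ℝ) ^ l)⁻¹ := by
  cases l with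
  | zero => simp [levelFactor, levelWeight, abs_of_nonneg (by positivity : 0 ≤ 1 + c / 3)]
  | succ g =>
    simp only [levelFactor, levelWeight, abs_mul, abs_of_nonneg hc, ← Finset.mul_sum, mul_assoc]
    exact mul_le_mul_of_nonneg_left
      ((sum_abs_levelKernel_le p hp g).trans_eq (by ring)) hc

lemma sum_levelFactor (p : ℕ) (c : ℝ) (G : ℕ) (k : ℤ) :
    ∑ l ∈ Finset.range (G + 1), levelFactor p c l k
      = 1 + c / 3 + c * ∑ g ∈ Finset.range G, levelKernel p g k := by
  rw [Finset.sum_range_succ', add_comm, Finset.mul_sum]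
  rfl

/-- The full series is `1 / (p ^ δ - 1)`, and `p ^ δ - 1 ≥ δ * log p`. This saves the logarithm in
the condition on the weights. -/
lemma sum_geometric_le {p : ℕ} (hp : 2 ≤ p) {δ : ℝ} (hδ : 0 < δ) (G : ℕ) :
    ∑ g ∈ Finset.range G, (((p : ℝ) ^ δ)⁻¹) ^ (g + 1) ≤ 1 / (δ * Real.log p) := by
  have hp1 : (1 : ℝ) < p := by exact_mod_cast hp
  have hlog : 0 < δ * Real.log p := mul_pos hδ (Real.log_pos hp1)
  have h1 : δ * Real.log p ≤ (p : ℝ) ^ δ - 1 := by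
    rw [Real.rpow_def_of_pos (by positivity), mul_comm]
    linarith [Real.add_one_le_exp (Real.log p * δ)]
  set q : ℝ := ((p : ℝ) ^ δ)⁻¹ with hq
  have hpδ : 1 < (p : ℝ) ^ δ := Real.one_lt_rpow hp1 hδ
  have hq0 : 0 ≤ q := by positivity
  have hq1 : q < 1 := inv_lt_one_of_one_lt₀ hpδ
  have hsum : ∑ g ∈ Finset.range G, q ^ g ≤ (1 - q)⁻¹ := by
    rw [← tsum_geometric_of_lt_one hq0 hq1]
    exact (summable_geometric_of_lt_one hq0 hq1).sum_le_tsum _ fun _ _ => by positivity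
  simp_rw [pow_succ', ← Finset.mul_sum]
  calc q * ∑ g ∈ Finset.range G, q ^ g ≤ q * (1 - q)⁻¹ := by gcongr
    _ = 1 / ((p : ℝ) ^ δ - 1) := by
      have : (p : ℝ) ^ δ - 1 ≠ 0 := by linarith
      have h2 : 1 - q ≠ 0 := by linarith
      rw [hq] at h2 ⊢
      field_simp
    _ ≤ 1 / (δ * Real.log p) := one_div_le_one_div_of_le hlog h1

lemma sum_levelWeight_le {p : ℕ} (hp : 2 ≤ p) {c : ℝ} (hc : 0 ≤ c) {δ : ℝ} (hδ : 0 < δ) (G : ℕ) :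
    ∑ l ∈ Finset.range (G + 1), levelWeight p c l * (((p : ℝ) ^ δ)⁻¹) ^ l
      ≤ 1 + c * (1 / 3 + (p : ℝ) ^ 2 / (6 * δ * Real.log p)) := by
  rw [Finset.sum_range_succ']
  simp only [levelWeight, ← Finset.mul_sum, pow_zero, mul_one]
  have h := mul_le_mul_of_nonneg_left (sum_geometric_le hp hδ G)
    (by positivity : 0 ≤ c * ((p : ℝ) ^ 2 / 6))
  have hlog : Real.log p ≠ 0 := (Real.log_pos (by exact_mod_cast hp)).ne'
  refine (add_le_add_left h _).trans_eq ?_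
  field_simp
  ring

section DoubleSum

variable {ι : Type*} [Fintype ι] {p : ι → ℕ} {c : ι → ℝ}

/-- A number in `[0, 1]` is at most its power `δ ≤ 1`. The loss of `N ^ δ` buys the decay `M ^
(-δ)`, which makes the sum over the levels converge. -/
lemma mod_div_le_rpow (N : ℕ) {M : ℕ} (hM : 0 < M) {δ : ℝ} (hδ : 0 < δ) (hδ1 : δ ≤ 1) :
    ((N % M : ℕ) : ℝ) / M ≤ ((N : ℝ) / M) ^ δ := by
  have hM' : (0 : ℝ) < M := by exact_mod_cast hM
  have h1 : ((N % M : ℕ) : ℝ) / M ≤ 1 :=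
    div_le_one_of_le₀ (by exact_mod_cast (Nat.mod_lt N hM).le) hM'.le
  have h2 : ((N % M : ℕ) : ℝ) / M ≤ N / M := by
    gcongr
    exact Nat.mod_le N M
  have h0 : 0 ≤ ((N % M : ℕ) : ℝ) / M := by positivity
  exact (Real.self_le_rpow_of_le_one h0 h1 hδ1).trans (Real.rpow_le_rpow h0 h2 hδ.le)

/-- Coprime periods let sums over the period `∏ⱼ pⱼ ^ lⱼ` factor. One positive level makes the mean
vanish, so the autocorrelation bound applies. -/
lemma abs_sum_sum_prod_levelFactor_le (hp : ∀ j, 0 < p j)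
    (hcop : Pairwise fun i j => Nat.Coprime (p i) (p j)) (hc : ∀ j, 0 ≤ c j) {δ : ℝ} (hδ : 0 < δ)
    (hδ1 : δ ≤ 1) (N : ℕ) {l : ι → ℕ} (hl : l ≠ 0) :
    |∑ n ∈ Finset.range N, ∑ m ∈ Finset.range N,
        ∏ j, levelFactor (p j) (c j) (l j) ((n : ℤ) - m)|
      ≤ (N : ℝ) ^ δ * ∏ j, (levelWeight (p j) (c j) (l j) * (((p j : ℝ) ^ δ)⁻¹) ^ l j) := by
  have hper : ∀ j, Function.Periodic (levelFactor (p j) (c j) (l j)) ((p j ^ l j : ℕ) : ℤ) :=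
    fun j => levelFactor_periodic (hp j) (c j) (l j)
  have hperabs : ∀ j, Function.Periodic (fun k => |levelFactor (p j) (c j) (l j) k|)
      ((p j ^ l j : ℕ) : ℤ) := fun j k => by simp only [hper j k]
  have hcop' : Pairwise fun i j => Nat.Coprime (p i ^ l i) (p j ^ l j) := fun i j hij =>
    Nat.Coprime.pow _ _ (hcop hij)
  have hM : 0 < ∏ j, p j ^ l j := Finset.prod_pos fun j _ => pow_pos (hp j) _
  have hW : 0 ≤ ∏ j, levelWeight (p j) (c j) (l j) :=
    Finset.prod_nonneg fun j _ => levelWeight_nonneg _ (hc j) _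
  have hmean : ∑ k ∈ Finset.range (∏ j, p j ^ l j),
      ∏ j, levelFactor (p j) (c j) (l j) (k : ℤ) = 0 := by
    rw [sum_range_prod _ hper hcop']
    obtain ⟨j, hj⟩ := Function.ne_iff.1 hl
    refine Finset.prod_eq_zero (Finset.mem_univ j) ?_
    obtain ⟨g, hg⟩ := Nat.exists_eq_succ_of_ne_zero hj
    rw [hg]
    simp only [levelFactor, Nat.succ_eq_add_one, ← Finset.mul_sum, sum_levelKernel _ (hp j),
      mul_zero]
  have habs : ∑ k ∈ Finset.range (∏ j, p j ^ l j),
      |∏ j, levelFactor (p j) (c j) (l j) (k : ℤ)|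
      ≤ (∏ j, levelWeight (p j) (c j) (l j)) * ((∏ j, p j ^ l j : ℕ) : ℝ)⁻¹ := by
    simp_rw [Finset.abs_prod]
    rw [sum_range_prod _ hperabs hcop']
    push_cast
    rw [← Finset.prod_inv_distrib, ← Finset.prod_mul_distrib]
    exact Finset.prod_le_prod (fun j _ => Finset.sum_nonneg fun _ _ => abs_nonneg _)
      fun j _ => sum_abs_levelFactor_le (hp j) (hc j) (l j)
  have hpow : (((N : ℝ) / (∏ j, p j ^ l j : ℕ)) ^ δ)
      = (N : ℝ) ^ δ * ∏ j, (((p j : ℝ) ^ δ)⁻¹) ^ l j := by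
    rw [Real.div_rpow (by positivity) (by positivity), div_eq_mul_inv]
    congr 1
    push_cast
    rw [← Real.finsetProd_rpow _ _ fun j _ => by positivity, ← Finset.prod_inv_distrib]
    refine Finset.prod_congr rfl fun j _ => ?_
    rw [inv_pow, ← Real.rpow_natCast, ← Real.rpow_natCast, ← Real.rpow_mul (by positivity),
      ← Real.rpow_mul (by positivity), mul_comm]
  refine (abs_sum_sum_sub_le (periodic_prod Finset.univ hper) hmean hM N).trans ?_
  refine (mul_le_mul_of_nonneg_left habs (Nat.cast_nonneg _)).trans ?_
  rw [Finset.prod_mul_distrib, mul_left_comm, mul_left_comm ((N : ℝ) ^ δ), ← hpow,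
    ← div_eq_mul_inv]
  exact mul_le_mul_of_nonneg_left (mod_div_le_rpow N hM hδ hδ1) hW

/-- The double sums of the product kernels truncated at level `G`. -/
lemma sum_sum_prod_sub_le (hp : ∀ j, 2 ≤ p j)
    (hcop : Pairwise fun i j => Nat.Coprime (p i) (p j)) (hc : ∀ j, 0 ≤ c j) {δ : ℝ} (hδ : 0 < δ)
    (hδ1 : δ ≤ 1) (N G : ℕ) :
    ∑ n ∈ Finset.range N, ∑ m ∈ Finset.range N,
        ∏ j, (1 + c j / 3 + c j * ∑ g ∈ Finset.range G, levelKernel (p j) g ((n : ℤ) - m))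
        - (N : ℝ) ^ 2 * ∏ j, (1 + c j / 3)
      ≤ (N : ℝ) ^ δ * ∏ j, (1 + c j * (1 / 3 + (p j : ℝ) ^ 2 / (6 * δ * Real.log (p j)))) := by
  classical
  have hp0 : ∀ j, 0 < p j := fun j => by have := hp j; lia
  set L : Finset (ι → ℕ) := Fintype.piFinset fun _ => Finset.range (G + 1) with hL
  have h0L : (0 : ι → ℕ) ∈ L := by simp [hL]
  have hexp : ∑ n ∈ Finset.range N, ∑ m ∈ Finset.range N,
      ∏ j, (1 + c j / 3 + c j * ∑ g ∈ Finset.range G, levelKernel (p j) g ((n : ℤ) - m))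
      = ∑ l ∈ L, ∑ n ∈ Finset.range N, ∑ m ∈ Finset.range N,
        ∏ j, levelFactor (p j) (c j) (l j) ((n : ℤ) - m) := by
    simp_rw [← sum_levelFactor, Finset.prod_univ_sum]
    rw [Finset.sum_comm (s := L)]
    exact Finset.sum_congr rfl fun n _ => Finset.sum_comm
  have hzero : ∑ n ∈ Finset.range N, ∑ m ∈ Finset.range N,
      ∏ j, levelFactor (p j) (c j) ((0 : ι → ℕ) j) ((n : ℤ) - m)
      = (N : ℝ) ^ 2 * ∏ j, (1 + c j / 3) := by
    simp [levelFactor]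
    ring
  have hterm : ∀ l : ι → ℕ, 0 ≤ (N : ℝ) ^ δ *
      ∏ j, (levelWeight (p j) (c j) (l j) * (((p j : ℝ) ^ δ)⁻¹) ^ l j) := fun l =>
    mul_nonneg (by positivity) (Finset.prod_nonneg fun j _ =>
      mul_nonneg (levelWeight_nonneg _ (hc j) _) (by positivity))
  -- The zero vector of levels gives exactly the subtracted term.
  rw [hexp, ← Finset.sum_erase_add L _ h0L, hzero, add_sub_cancel_right]
  calc ∑ l ∈ L.erase 0, ∑ n ∈ Finset.range N, ∑ m ∈ Finset.range N,
        ∏ j, levelFactor (p j) (c j) (l j) ((n : ℤ) - m)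
      ≤ ∑ l ∈ L.erase 0, (N : ℝ) ^ δ *
          ∏ j, (levelWeight (p j) (c j) (l j) * (((p j : ℝ) ^ δ)⁻¹) ^ l j) :=
        Finset.sum_le_sum fun l hl => (le_abs_self _).trans
          (abs_sum_sum_prod_levelFactor_le hp0 hcop hc hδ hδ1 N (Finset.ne_of_mem_erase hl))
    -- Restoring `l = 0` makes the index set a box, so that the sum factors over the coordinates.
    _ ≤ ∑ l ∈ L, (N : ℝ) ^ δ *
          ∏ j, (levelWeight (p j) (c j) (l j) * (((p j : ℝ) ^ δ)⁻¹) ^ l j) :=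
        Finset.sum_le_sum_of_subset_of_nonneg (Finset.erase_subset _ _) fun l _ _ => hterm l
    _ = (N : ℝ) ^ δ * ∏ j, ∑ l ∈ Finset.range (G + 1),
          levelWeight (p j) (c j) l * (((p j : ℝ) ^ δ)⁻¹) ^ l := by
        rw [← Finset.mul_sum, Finset.prod_univ_sum]
    _ ≤ _ := by
        refine mul_le_mul_of_nonneg_left (Finset.prod_le_prod (fun j _ => ?_) fun j _ =>
          sum_levelWeight_le (hp j) (hc j) hδ G) (by positivity)
        exact Finset.sum_nonneg fun l _ =>
          mul_nonneg (levelWeight_nonneg _ (hc j) _) (by positivity)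

end DoubleSum

/-! ### Digits of real numbers and of `p`-adic integers -/

section Shift

open Filter Topology

variable (p : ℕ)

lemma truncRadicalInverse_sum_digits (G : ℕ) (d : ℕ → Fin p) :
    truncRadicalInverse p G (∑ r ∈ Finset.range G, (d r : ℕ) * p ^ r : ℕ)
      = ∑ r ∈ Finset.range G, Real.ofDigitsTerm d r := by
  induction G generalizing d with
  | zero => simp [truncRadicalInverse]
  | succ G ih =>
    have hp : (p : ℝ) ≠ 0 := by
      have := (d 0).pos
      positivity
    have h : ((∑ r ∈ Finset.range (G + 1), (d r : ℕ) * p ^ r : ℕ) : ℤ)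
        = (d 0 : ℕ) + p * (∑ r ∈ Finset.range G, (d (r + 1) : ℕ) * p ^ r : ℕ) := by
      rw [Finset.sum_range_succ']
      push_cast
      rw [Finset.mul_sum, add_comm, pow_zero, mul_one]
      congr 1
      exact Finset.sum_congr rfl fun r _ => by ring
    rw [h, truncRadicalInverse_succ p (by lia) (by exact_mod_cast (d 0).2),
      ih fun r => d (r + 1), Finset.sum_range_succ', add_div, Finset.sum_div, add_comm]
    congr 1
    · refine Finset.sum_congr rfl fun r _ => ?_
      simp only [Real.ofDigitsTerm]
      field_simp
      ring
    · simp [Real.ofDigitsTerm, div_eq_mul_inv]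

lemma tendsto_truncRadicalInverse (d : ℕ → Fin p) :
    Tendsto (fun G => truncRadicalInverse p G (∑ r ∈ Finset.range G, (d r : ℕ) * p ^ r : ℕ))
      atTop (𝓝 (Real.ofDigits d)) := by
  simp_rw [truncRadicalInverse_sum_digits]
  exact Real.summable_ofDigitsTerm.hasSum.tendsto_sum_nat

lemma sum_digits_lt (G : ℕ) (d : ℕ → Fin p) :
    ∑ r ∈ Finset.range G, (d r : ℕ) * p ^ r < p ^ G := by
  induction G with
  | zero => simp
  | succ G ih =>
    rw [Finset.sum_range_succ, pow_succ]
    have h : (d G : ℕ) + 1 ≤ p := (d G).2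
    nlinarith [Nat.mul_le_mul_right (p ^ G) h]

lemma eq_of_sum_digits_eq (hp : 0 < p) {d e : ℕ → Fin p}
    (h : ∀ G, ∑ r ∈ Finset.range G, (d r : ℕ) * p ^ r = ∑ r ∈ Finset.range G, (e r : ℕ) * p ^ r) :
    d = e := by
  ext r
  have h1 := h (r + 1)
  rw [Finset.sum_range_succ, Finset.sum_range_succ, h r, Nat.add_left_cancel_iff] at h1
  exact Nat.eq_of_mul_eq_mul_right (by positivity) h1

/-- The hypothesis excludes tails consisting of digits `p - 1` only, so that the floor reads off the
given digits. -/
lemma digits_ofDigits [NeZero p] {d : ℕ → Fin p}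
    (h : ∀ n, Real.ofDigits (fun i => d (i + n)) < 1) : Real.digits (Real.ofDigits d) p = d := by
  have hp : (p : ℝ) ≠ 0 := by exact_mod_cast NeZero.ne p
  have hK : ∀ n, ∃ K : ℕ, (p : ℝ) ^ n * ∑ i ∈ Finset.range n, Real.ofDigitsTerm d i = K := by
    intro n
    induction n with
    | zero => exact ⟨0, by simp⟩
    | succ n ih =>
      obtain ⟨K, hK⟩ := ih
      refine ⟨p * K + d n, ?_⟩
      push_cast
      rw [← hK, Finset.sum_range_succ, Real.ofDigitsTerm]
      field_simp
      ring
  funext i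
  obtain ⟨K, hK⟩ := hK i
  have h1 : Real.ofDigits d * (p : ℝ) ^ (i + 1)
      = Real.ofDigits (fun k => d (k + (i + 1))) + (p * K + d i : ℕ) := by
    push_cast
    rw [Real.ofDigits_eq_sum_add_ofDigits d (i + 1), ← hK, Finset.sum_range_succ,
      Real.ofDigitsTerm]
    field_simp
    ring
  rw [Real.digits, h1, Nat.floor_add_natCast (Real.ofDigits_nonneg _),
    Nat.floor_eq_zero.2 (h (i + 1)), zero_add]
  ext
  rw [Fin.val_ofNat, Nat.mul_add_mod, Nat.mod_eq_of_lt (d i).2]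

/-- All digits must equal `p - 1`. -/
lemma eq_of_ofDigits_eq_one {d e : ℕ → Fin p} (hd : Real.ofDigits d = 1)
    (he : Real.ofDigits e = 1) : d = e := by
  have key : ∀ (r : ℕ) (d : ℕ → Fin p), Real.ofDigits d = 1 → (d r : ℕ) + 1 = p := by
    intro r
    induction r with
    | zero =>
      intro d hd
      have hp : (0 : ℝ) < p := by exact_mod_cast (d 0).pos
      have h1 := Real.ofDigits_eq_sum_add_ofDigits d 1
      have h2 := Real.ofDigits_le_one fun i => d (i + 1)
      rw [hd] at h1
      simp only [Finset.sum_range_one, Real.ofDigitsTerm, zero_add, pow_one, ← add_mul,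
        mul_comm (p : ℝ)⁻¹] at h1
      rw [← div_eq_mul_inv, eq_div_iff hp.ne', one_mul] at h1
      have h3 : (p : ℝ) ≤ (d 0 : ℕ) + 1 := by linarith
      have h4 : p ≤ (d 0 : ℕ) + 1 := by exact_mod_cast h3
      have := (d 0).2
      lia
    | succ r ih =>
      intro d hd
      refine ih (fun i => d (i + 1)) ?_
      have hp : (0 : ℝ) < p := by exact_mod_cast (d 0).pos
      have h1 := Real.ofDigits_eq_sum_add_ofDigits d 1
      have h2 := Real.ofDigits_le_one fun i => d (i + 1)
      rw [hd] at h1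
      simp only [Finset.sum_range_one, Real.ofDigitsTerm, zero_add, pow_one, ← add_mul,
        mul_comm (p : ℝ)⁻¹] at h1
      rw [← div_eq_mul_inv, eq_div_iff hp.ne', one_mul] at h1
      have h3 : ((d 0 : ℕ) : ℝ) + 1 ≤ p := by exact_mod_cast (d 0).2
      linarith
  ext r
  have h1 := key r d hd
  have h2 := key r e he
  lia

variable [hp : Fact p.Prime]

lemma appr_eq_sum_padicDigit (z : ℤ_[p]) (G : ℕ) :
    z.appr G = ∑ r ∈ Finset.range G, (padicDigit p z r : ℕ) * p ^ r := by
  induction G with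
  | zero => simp [PadicInt.appr]
  | succ G ih =>
    have h1 : z.appr (G + 1) % p ^ G = z.appr G := by
      obtain ⟨c, hc⟩ := z.dvd_appr_sub_appr G (G + 1) (Nat.le_succ G)
      have hmono := z.appr_mono (Nat.le_succ G)
      have : z.appr (G + 1) = z.appr G + p ^ G * c := by
        have hmono' : z.appr G ≤ z.appr (G + 1) := hmono
        lia
      rw [this, Nat.add_mul_mod_self_left, Nat.mod_eq_of_lt (z.appr_lt G)]
    have h2 := Nat.mod_pow_succ (b := p) (k := G) (x := z.appr (G + 1))
    rw [Nat.mod_eq_of_lt (z.appr_lt (G + 1)), h1] at h2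
    rw [Finset.sum_range_succ, ← ih, padicDigit, Fin.val_ofNat, mul_comm]
    exact h2

lemma tendsto_truncRadicalInverse_appr (z : ℤ_[p]) :
    Tendsto (fun G => truncRadicalInverse p G (z.appr G)) atTop
      (𝓝 (Real.ofDigits (padicDigit p z))) := by
  simp_rw [appr_eq_sum_padicDigit]
  exact tendsto_truncRadicalInverse p _

lemma summable_digits_mul_pow (d : ℕ → Fin p) :
    Summable fun r : ℕ => ((d r : ℕ) : ℤ_[p]) * (p : ℤ_[p]) ^ r := by
  have hp1 : (1 : ℝ) < p := by exact_mod_cast hp.out.one_lt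
  refine Summable.of_norm_bounded (g := fun r : ℕ => ((p : ℝ)⁻¹) ^ r)
    (summable_geometric_of_lt_one (by positivity) (inv_lt_one_of_one_lt₀ hp1)) fun r => ?_
  rw [norm_mul, norm_pow, PadicInt.norm_p]
  exact mul_le_of_le_one_left (by positivity) (PadicInt.norm_le_one _)

/-- The natural number whose base `p` digits are the first `G` digits of a real number, in reversed
order. -/
noncomputable def reversedDigits (G : ℕ) (x : ℝ) : ℕ :=
  ∑ r ∈ Finset.range G, (Real.digits x p r : ℕ) * p ^ r

lemma invMonnaMap_sub_mem (x : ℝ) (G : ℕ) :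
    invMonnaMap p x - (reversedDigits p G x : ℕ) ∈ Ideal.span {(p : ℤ_[p]) ^ G} := by
  have h := (summable_digits_mul_pow p (Real.digits x p)).sum_add_tsum_nat_add G
  rw [invMonnaMap, ← h, reversedDigits]
  push_cast
  rw [add_sub_cancel_left, Ideal.mem_span_singleton]
  refine ⟨∑' r : ℕ, ((Real.digits x p (r + G) : ℕ) : ℤ_[p]) * (p : ℤ_[p]) ^ r, ?_⟩
  rw [← Summable.tsum_mul_left _ (summable_digits_mul_pow p fun r => Real.digits x p (r + G))]
  exact tsum_congr fun r => by ring

lemma appr_natCast_add_invMonnaMap (n : ℕ) (x : ℝ) (G : ℕ) :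
    ((n : ℤ_[p]) + invMonnaMap p x).appr G ≡ reversedDigits p G x + n [MOD p ^ G] := by
  rw [← ZMod.natCast_eq_natCast_iff]
  refine PadicInt.zmod_congr_of_sub_mem_span G ((n : ℤ_[p]) + invMonnaMap p x) _ _
    (PadicInt.appr_spec G _) ?_
  convert invMonnaMap_sub_mem p x G using 1
  push_cast
  ring

/-- Modulo `p ^ G` the shift is addition of `n` to an integer, and periodicity takes care of the
overflow. -/
lemma truncRadicalInverse_appr (n : ℕ) (x : ℝ) (G : ℕ) :
    truncRadicalInverse p G (((n : ℤ_[p]) + invMonnaMap p x).appr G)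
      = truncRadicalInverse p G (reversedDigits p G x + n) := by
  have h := (Int.natCast_modEq_iff.2 (appr_natCast_add_invMonnaMap p n x G)).symm
  obtain ⟨c, hc⟩ := Int.modEq_iff_add_fac.1 h
  rw [hc, mul_comm]
  push_cast
  exact_mod_cast (truncRadicalInverse_periodic p hp.out.pos G).int_mul c _

lemma radicalInverse_lt_one (n : ℕ) : radicalInverse p n < 1 := by
  refine lt_of_le_of_ne (Real.ofDigits_le_one _) fun h => ?_
  have h1 := eq_of_ofDigits_eq_one p h (Real.ofDigits_const_last_eq_one' hp.out.one_lt)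
  have h2 := congrArg Fin.val (congrFun h1 n)
  rw [Fin.val_ofNat, Nat.div_eq_of_lt (Nat.lt_pow_self hp.out.one_lt), Nat.zero_mod] at h2
  have := hp.out.one_lt
  simp only at h2
  lia

lemma digits_radicalInverse (n r : ℕ) :
    (Real.digits (radicalInverse p n) p r : ℕ) = n / p ^ r % p := by
  rw [radicalInverse, digits_ofDigits p fun k => ?_, Fin.val_ofNat]
  refine lt_of_eq_of_lt ?_ (radicalInverse_lt_one p (n / p ^ k))
  rw [radicalInverse]
  congr 1
  funext i
  rw [Nat.div_div_eq_div_mul, pow_add, mul_comm]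

/-- The shifted point thus comes from the `p`-adic integer `n + invMonnaMap p σ`: `n` acts by
translation. -/
lemma invMonnaMap_radicalInverse (n : ℕ) : invMonnaMap p (radicalInverse p n) = n := by
  have hsum : ∀ G, ∑ r ∈ Finset.range G, n / p ^ r % p * p ^ r = n % p ^ G := by
    intro G
    induction G with
    | zero => simp [Nat.mod_one]
    | succ G ih => rw [Finset.sum_range_succ, ih, Nat.mod_pow_succ, mul_comm]
  simp_rw [invMonnaMap, digits_radicalInverse]
  rw [tsum_eq_sum (s := Finset.range n) fun r hr => ?_]
  · have h := hsum n
    rw [Nat.mod_eq_of_lt (Nat.lt_pow_self hp.out.one_lt)] at h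
    conv_rhs => rw [← h]
    push_cast
    rfl
  · have hr' : n ≤ r := by simpa using hr
    rw [Nat.div_eq_of_lt (hr'.trans_lt (Nat.lt_pow_self hp.out.one_lt))]
    simp

/-- The `n`-th point of the van der Corput sequence, shifted by `σ`. -/
noncomputable def shiftedPoint (n : ℕ) (σ : ℝ) : ℝ :=
  padicShift p (radicalInverse p n) σ

lemma shiftedPoint_eq (n : ℕ) (σ : ℝ) :
    shiftedPoint p n σ = Int.fract (Real.ofDigits (padicDigit p (n + invMonnaMap p σ))) := by
  rw [shiftedPoint, padicShift, invMonnaMap_radicalInverse, monnaMap]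

lemma shiftedPoint_mem (n : ℕ) (σ : ℝ) : shiftedPoint p n σ ∈ unitInterval :=
  padicShift_mem p _ _

lemma measurable_digits (r : ℕ) : Measurable fun x : ℝ => Real.digits x p r := by
  unfold Real.digits
  exact (measurable_from_top (f := fun k : ℕ => Fin.ofNat p k)).comp
    (Nat.measurable_floor.comp (measurable_id.mul_const _))

lemma measurable_reversedDigits (G : ℕ) : Measurable (reversedDigits p G) := by
  unfold reversedDigits
  refine Finset.measurable_sum _ fun r _ => ?_
  exact (measurable_from_top (f := fun k : Fin p => (k : ℕ) * p ^ r)).comp (measurable_digits p r)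

lemma reversedDigits_lt (G : ℕ) (x : ℝ) : reversedDigits p G x < p ^ G :=
  sum_digits_lt p G _

lemma measurable_shiftedPoint (n : ℕ) : Measurable (shiftedPoint p n) := by
  have h : Measurable fun σ => Real.ofDigits (padicDigit p (n + invMonnaMap p σ)) := by
    refine measurable_of_tendsto_metrizable (f := fun G σ =>
      truncRadicalInverse p G (reversedDigits p G σ + n)) (fun G => ?_) (tendsto_pi_nhds.2 fun σ => ?_)
    · exact (measurable_from_top (f := fun a : ℕ => truncRadicalInverse p G (a + n))).comp
        (measurable_reversedDigits p G)
    · simp_rw [← truncRadicalInverse_appr]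
      exact tendsto_truncRadicalInverse_appr p _
  have heq : shiftedPoint p n
      = fun σ => Int.fract (Real.ofDigits (padicDigit p (n + invMonnaMap p σ))) :=
    funext (shiftedPoint_eq p n)
  rw [heq]
  exact h.fract

/-- The fractional part in `monnaMap` matters only at the value `1`. There all digits are `p - 1`,
which determines the digits of the shift, so the exceptional set is null. -/
lemma subsingleton_ofDigits_eq_one (n : ℕ) :
    {σ ∈ Set.Ico (0 : ℝ) 1 |
      Real.ofDigits (padicDigit p (n + invMonnaMap p σ)) = 1}.Subsingleton := by
  rintro σ ⟨hσ, h1⟩ τ ⟨hτ, h2⟩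
  have hdig := eq_of_ofDigits_eq_one p h1 h2
  have happr : ∀ G, reversedDigits p G σ = reversedDigits p G τ := by
    intro G
    have h3 := appr_natCast_add_invMonnaMap p n σ G
    have h4 := appr_natCast_add_invMonnaMap p n τ G
    rw [appr_eq_sum_padicDigit, hdig, ← appr_eq_sum_padicDigit] at h3
    exact Nat.ModEq.eq_of_lt_of_lt (Nat.ModEq.add_right_cancel' n (h3.symm.trans h4))
      (reversedDigits_lt p G σ) (reversedDigits_lt p G τ)
  rw [← Real.ofDigits_digits hp.out.one_lt hσ, ← Real.ofDigits_digits hp.out.one_lt hτ,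
    eq_of_sum_digits_eq p hp.out.pos happr]

lemma ae_tendsto_shiftedPoint (n : ℕ) :
    ∀ᵐ σ ∂(volume.restrict (Set.Ico (0 : ℝ) 1)),
      Tendsto (fun G => truncRadicalInverse p G (reversedDigits p G σ + n)) atTop
        (𝓝 (shiftedPoint p n σ)) := by
  have h0 := (subsingleton_ofDigits_eq_one p n).measure_zero volume
  rw [ae_restrict_iff' measurableSet_Ico]
  filter_upwards [measure_eq_zero_iff_ae_notMem.1 h0] with σ hσ hσ1
  have hne : Real.ofDigits (padicDigit p (n + invMonnaMap p σ)) ≠ 1 := fun h => hσ ⟨hσ1, h⟩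
  rw [shiftedPoint_eq, Int.fract_eq_self.2 ⟨Real.ofDigits_nonneg _,
    lt_of_le_of_ne (Real.ofDigits_le_one _) hne⟩]
  simp_rw [← truncRadicalInverse_appr]
  exact tendsto_truncRadicalInverse_appr p _

/-! ### Averages over the shift -/

/-- Passing from `τ` to `(d + τ) / p` prepends the digit `d`. -/
lemma reversedDigits_succ {d : ℕ} (hd : d < p) (G : ℕ) {τ : ℝ} (hτ : τ ∈ Set.Ico (0 : ℝ) 1) :
    reversedDigits p (G + 1) ((d + τ) / p) = d + p * reversedDigits p G τ := by
  have hp0 : (p : ℝ) ≠ 0 := by exact_mod_cast hp.out.ne_zero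
  have hdig : ∀ r, ⌊(d + τ) / p * (p : ℝ) ^ (r + 1)⌋₊ = ⌊τ * (p : ℝ) ^ r⌋₊ + d * p ^ r := by
    intro r
    have : (d + τ) / p * (p : ℝ) ^ (r + 1) = τ * (p : ℝ) ^ r + (d * p ^ r : ℕ) := by
      push_cast
      field_simp
      ring
    rw [this, Nat.floor_add_natCast (mul_nonneg hτ.1 (by positivity))]
  rw [reversedDigits, Finset.sum_range_succ', reversedDigits, Finset.mul_sum, add_comm]
  congr 1
  · rw [Real.digits, Fin.val_ofNat, hdig 0, pow_zero, pow_zero, mul_one, mul_one, mul_one,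
      Nat.floor_eq_zero.2 hτ.2, zero_add, Nat.mod_eq_of_lt hd]
  · refine Finset.sum_congr rfl fun r _ => ?_
    rw [Real.digits, Real.digits, Fin.val_ofNat, Fin.val_ofNat, hdig (r + 1),
      show d * p ^ (r + 1) = d * p ^ r * p by ring, Nat.add_mul_mod_self_right]
    ring

lemma intervalIntegrable_comp_reversedDigits (G : ℕ) (h : ℕ → ℝ) (a b : ℝ) :
    IntervalIntegrable (fun σ => h (reversedDigits p G σ)) volume a b := by
  have hm : Measurable fun σ => h (reversedDigits p G σ) :=
    (measurable_from_top (f := h)).comp (measurable_reversedDigits p G)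
  rw [intervalIntegrable_iff]
  refine Measure.integrableOn_of_bounded (M := ∑ a ∈ Finset.range (p ^ G), |h a|)
    (by simp [Set.uIoc]) hm.aestronglyMeasurable (ae_of_all _ fun σ => ?_)
  exact Finset.single_le_sum (f := fun a => |h a|) (fun _ _ => abs_nonneg _)
    (Finset.mem_range.2 (reversedDigits_lt p G σ))

/-- The first digits of a uniformly distributed number are uniformly distributed. -/
lemma integral_comp_reversedDigits (G : ℕ) (h : ℕ → ℝ) :
    ∫ σ in (0 : ℝ)..1, h (reversedDigits p G σ)
      = ((p : ℝ) ^ G)⁻¹ * ∑ a ∈ Finset.range (p ^ G), h a := by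
  have hp0 : (p : ℝ) ≠ 0 := by exact_mod_cast hp.out.ne_zero
  induction G generalizing h with
  | zero => simp [reversedDigits]
  | succ G ih =>
    -- The unit interval is split according to the first digit; each piece is a scaled copy of the
    -- whole.
    have hsplit := intervalIntegral.sum_integral_adjacent_intervals (μ := volume)
      (f := fun σ => h (reversedDigits p (G + 1) σ)) (a := fun k : ℕ => (k : ℝ) / p) (n := p)
      fun k _ => intervalIntegrable_comp_reversedDigits p (G + 1) h _ _
    simp only [Nat.cast_zero, zero_div, div_self hp0] at hsplit
    have hpiece : ∀ d ∈ Finset.range p,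
        ∫ σ in (d : ℝ) / p..((d + 1 : ℕ) : ℝ) / p, h (reversedDigits p (G + 1) σ)
          = (p : ℝ)⁻¹ * (((p : ℝ) ^ G)⁻¹ * ∑ a ∈ Finset.range (p ^ G), h (d + p * a)) := by
      intro d hd
      have hsub := intervalIntegral.integral_comp_add_div
        (f := fun σ => h (reversedDigits p (G + 1) σ)) (a := 0) (b := 1) hp0 ((d : ℝ) / p)
      have hcongr : ∫ τ in (0 : ℝ)..1, h (reversedDigits p (G + 1) ((d : ℝ) / p + τ / p))
          = ∫ τ in (0 : ℝ)..1, h (d + p * reversedDigits p G τ) := by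
        rw [intervalIntegral.integral_of_le zero_le_one, intervalIntegral.integral_of_le zero_le_one,
          ← integral_Ico_eq_integral_Ioc, ← integral_Ico_eq_integral_Ioc]
        refine setIntegral_congr_fun measurableSet_Ico fun τ hτ => ?_
        rw [← add_div, reversedDigits_succ p (Finset.mem_range.1 hd) G hτ]
      rw [← ih fun a => h (d + p * a), ← hcongr, hsub, smul_eq_mul, inv_mul_cancel_left₀ hp0,
        zero_div, add_zero, ← add_div]
      push_cast
      rfl
    rw [← hsplit, Finset.sum_congr rfl hpiece, pow_succ' p G, sum_range_mul, Finset.sum_comm,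
      pow_succ', mul_inv, ← Finset.mul_sum, ← Finset.mul_sum, mul_assoc]

/-- Joint moments of two shifted points as limits of averages over residue classes. -/
lemma tendsto_average_shiftedPoint {F : ℝ × ℝ → ℝ} (hF : Continuous F) (n m : ℕ) :
    Tendsto (fun G => ((p : ℝ) ^ G)⁻¹ * ∑ a ∈ Finset.range (p ^ G),
      F (truncRadicalInverse p G (a + n), truncRadicalInverse p G (a + m))) atTop
      (𝓝 (∫ σ in Set.Ico (0 : ℝ) 1, F (shiftedPoint p n σ, shiftedPoint p m σ))) := by
  obtain ⟨C, hC⟩ := (isCompact_Icc.prod isCompact_Icc :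
    IsCompact (Set.Icc (0 : ℝ) 1 ×ˢ Set.Icc (0 : ℝ) 1)).exists_bound_of_continuousOn
      hF.continuousOn
  have heq : ∀ G, ((p : ℝ) ^ G)⁻¹ * ∑ a ∈ Finset.range (p ^ G),
      F (truncRadicalInverse p G (a + n), truncRadicalInverse p G (a + m))
      = ∫ σ in Set.Ico (0 : ℝ) 1, F (truncRadicalInverse p G (reversedDigits p G σ + n),
        truncRadicalInverse p G (reversedDigits p G σ + m)) := fun G => by
    rw [integral_Ico_eq_integral_Ioc, ← intervalIntegral.integral_of_le zero_le_one]
    exact (integral_comp_reversedDigits p G fun a =>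
      F (truncRadicalInverse p G (a + n), truncRadicalInverse p G (a + m))).symm
  simp_rw [heq]
  refine tendsto_integral_of_dominated_convergence (fun _ => C) (fun G => ?_)
    (integrable_const C) (fun G => ae_of_all _ fun σ => hC _ ?_) ?_
  · exact ((measurable_from_top (f := fun a : ℕ => F (truncRadicalInverse p G (a + n),
      truncRadicalInverse p G (a + m)))).comp (measurable_reversedDigits p G)).aestronglyMeasurable
  · exact ⟨⟨truncRadicalInverse_nonneg p hp.out.pos G _, truncRadicalInverse_le_one p hp.out.pos G _⟩,
      ⟨truncRadicalInverse_nonneg p hp.out.pos G _, truncRadicalInverse_le_one p hp.out.pos G _⟩⟩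
  · filter_upwards [ae_tendsto_shiftedPoint p n, ae_tendsto_shiftedPoint p m] with σ h1 h2
    exact (hF.tendsto _).comp (h1.prodMk_nhds h2)

lemma shiftedPoint_zero {σ : ℝ} (hσ : σ ∈ Set.Ico (0 : ℝ) 1) : shiftedPoint p 0 σ = σ := by
  have h1 := tendsto_truncRadicalInverse_appr p ((0 : ℕ) + invMonnaMap p σ)
  simp_rw [truncRadicalInverse_appr] at h1
  have h2 := tendsto_truncRadicalInverse p (Real.digits σ p)
  rw [Real.ofDigits_digits hp.out.one_lt hσ] at h2
  have h3 : Real.ofDigits (padicDigit p ((0 : ℕ) + invMonnaMap p σ)) = σ :=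
    tendsto_nhds_unique h1 (by simpa [reversedDigits] using h2)
  rw [shiftedPoint_eq, h3, Int.fract_eq_self.2 hσ]

/-- The shifted points are uniformly distributed. -/
lemma integral_comp_shiftedPoint {f : ℝ → ℝ} (hf : Continuous f) (n : ℕ) :
    ∫ σ in Set.Ico (0 : ℝ) 1, f (shiftedPoint p n σ) = ∫ x in (0 : ℝ)..1, f x := by
  have h1 := tendsto_average_shiftedPoint p (hf.comp continuous_fst) n n
  have h2 := tendsto_average_shiftedPoint p (hf.comp continuous_fst) 0 0
  -- Averages over residues do not see the translation by `n`; this reduces to `n = 0`, where the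
  -- point is the shift itself.
  have heq : ∀ G, ∑ a ∈ Finset.range (p ^ G), f (truncRadicalInverse p G ((a : ℤ) + n))
      = ∑ a ∈ Finset.range (p ^ G), f (truncRadicalInverse p G ((a : ℤ) + (0 : ℕ))) := fun G => by
    have hper := (truncRadicalInverse_periodic p hp.out.pos G).comp f
    exact (sum_range_periodic_add hper n).trans (sum_range_periodic_add hper (0 : ℕ)).symm
  simp only [Function.comp_apply, heq] at h1 h2
  rw [tendsto_nhds_unique h1 h2, setIntegral_congr_fun measurableSet_Ico fun σ hσ =>
    congrArg f (shiftedPoint_zero p hσ), integral_Ico_eq_integral_Ioc,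
    intervalIntegral.integral_of_le zero_le_one]

lemma integrable_comp_shiftedPoint {F : ℝ × ℝ → ℝ} (hF : Continuous F) (n m : ℕ) :
    Integrable (fun σ => F (shiftedPoint p n σ, shiftedPoint p m σ))
      (volume.restrict (Set.Ico (0 : ℝ) 1)) := by
  obtain ⟨C, hC⟩ := (isCompact_Icc.prod isCompact_Icc :
    IsCompact (Set.Icc (0 : ℝ) 1 ×ˢ Set.Icc (0 : ℝ) 1)).exists_bound_of_continuousOn
      hF.continuousOn
  exact Integrable.of_bound (hF.measurable.comp ((measurable_shiftedPoint p n).prodMk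
    (measurable_shiftedPoint p m))).aestronglyMeasurable C
    (ae_of_all _ fun σ => hC _ ⟨shiftedPoint_mem p n σ, shiftedPoint_mem p m σ⟩)

/-- The shift average of the kernel `min (1 - x) (1 - y)`. -/
noncomputable def shiftedMin (n m : ℕ) : ℝ :=
  ∫ σ in Set.Ico (0 : ℝ) 1, min (1 - shiftedPoint p n σ) (1 - shiftedPoint p m σ)

/-- Here `min (1 - x) (1 - y) = 1 - (x + y) / 2 - |x - y| / 2`, and uniformity evaluates the linear
part. -/
lemma shiftedMin_eq (n m : ℕ) :
    shiftedMin p n m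
      = 1 / 2 - (∫ σ in Set.Ico (0 : ℝ) 1, |shiftedPoint p n σ - shiftedPoint p m σ|) / 2 := by
  have hmin : ∀ x y : ℝ, min (1 - x) (1 - y) = (1 - x / 2 - y / 2) - |x - y| / 2 := by
    intro x y
    rcases le_total x y with h | h
    · rw [min_eq_right (by linarith), abs_of_nonpos (by linarith)]
      ring
    · rw [min_eq_left (by linarith), abs_of_nonneg (by linarith)]
      ring
  have hx : ∀ k, ∫ σ in Set.Ico (0 : ℝ) 1, shiftedPoint p k σ / 2 = 1 / 4 := fun k => by
    rw [integral_comp_shiftedPoint p (f := fun x => x / 2) (by fun_prop),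
      intervalIntegral.integral_div, integral_id]
    norm_num
  have hc : Integrable (fun _ => (1 : ℝ)) (volume.restrict (Set.Ico (0 : ℝ) 1)) :=
    integrable_const 1
  have h1 : Integrable (fun σ => shiftedPoint p n σ / 2) (volume.restrict (Set.Ico (0 : ℝ) 1)) :=
    integrable_comp_shiftedPoint p (F := fun q => q.1 / 2) (by fun_prop) n m
  have h2 : Integrable (fun σ => shiftedPoint p m σ / 2) (volume.restrict (Set.Ico (0 : ℝ) 1)) :=
    integrable_comp_shiftedPoint p (F := fun q => q.2 / 2) (by fun_prop) n m
  have h3 : Integrable (fun σ => |shiftedPoint p n σ - shiftedPoint p m σ| / 2)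
      (volume.restrict (Set.Ico (0 : ℝ) 1)) :=
    integrable_comp_shiftedPoint p (F := fun q => |q.1 - q.2| / 2) (by fun_prop) n m
  have h4 : Integrable (fun σ => 1 - shiftedPoint p n σ / 2)
      (volume.restrict (Set.Ico (0 : ℝ) 1)) := hc.sub h1
  have h5 : Integrable (fun σ => 1 - shiftedPoint p n σ / 2 - shiftedPoint p m σ / 2)
      (volume.restrict (Set.Ico (0 : ℝ) 1)) := h4.sub h2
  simp_rw [shiftedMin, hmin]
  rw [integral_sub h5 h3, integral_sub h4 h2, integral_sub hc h1, hx, hx, integral_div]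
  simp
  norm_num

lemma average_abs_sub_eq (n m : ℕ) (G : ℕ) :
    ((p : ℝ) ^ G)⁻¹ * ∑ a ∈ Finset.range (p ^ G),
      |truncRadicalInverse p G (a + n) - truncRadicalInverse p G (a + m)|
      = meanAbsDiff p G ((n : ℤ) - m) := by
  have hper : Function.Periodic (fun a : ℤ => |truncRadicalInverse p G (a + ((n : ℤ) - m))
      - truncRadicalInverse p G a|) ((p ^ G : ℕ) : ℤ) := fun a => by
    have h := truncRadicalInverse_periodic p hp.out.pos G
    simp only [h a, add_right_comm a, h (a + ((n : ℤ) - m))]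
  rw [meanAbsDiff, ← sum_range_periodic_add hper m]
  congr 1
  refine Finset.sum_congr rfl fun a _ => ?_
  rw [add_assoc, add_sub_cancel]

/-- The constant is `1 / 3 = 1 / 2 - 1 / 6`, from `shiftedMin_eq` and `sum_levelKernel_eq`; the
correction term of the latter tends to zero. -/
lemma tendsto_sum_levelKernel (n m : ℕ) :
    Tendsto (fun G => 1 / 3 + ∑ g ∈ Finset.range G, levelKernel p g ((n : ℤ) - m)) atTop
      (𝓝 (shiftedMin p n m)) := by
  have hp1 : (1 : ℝ) < p := by exact_mod_cast hp.out.one_lt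
  have h1 := tendsto_average_shiftedPoint p (F := fun q => |q.1 - q.2|) (by fun_prop) n m
  simp only [average_abs_sub_eq] at h1
  have hpow : Tendsto (fun G : ℕ => ((p : ℝ) ^ G)⁻¹ / 6) atTop (𝓝 0) := by
    simpa [inv_pow] using (tendsto_pow_atTop_nhds_zero_of_lt_one (by positivity)
      (inv_lt_one_of_one_lt₀ hp1)).div_const 6
  have h2 : Tendsto (fun G : ℕ => if (p : ℤ) ^ G ∣ (n : ℤ) - m then ((p : ℝ) ^ G)⁻¹ / 6 else 0)
      atTop (𝓝 0) := by
    refine squeeze_zero (fun G => ?_) (fun G => ?_) hpow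
    · split_ifs <;> positivity
    · split_ifs
      · exact le_rfl
      · positivity
  rw [shiftedMin_eq]
  have h3 := ((tendsto_const_nhds (x := (1 / 2 : ℝ))).sub (h1.div_const 2)).sub h2
  rw [sub_zero] at h3
  refine h3.congr fun G => ?_
  rw [sum_levelKernel_eq p hp.out.pos]
  ring

end Shift

/-! ### The mean square error of the shifted Halton sequence -/

section Halton

open Filter Topology

lemma shiftLaw_eq_pi (s : ℕ) :
    shiftLaw s = Measure.pi fun _ : Fin s => (volume : Measure ℝ).restrict (Set.Ico 0 1) := by
  rw [shiftLaw, volume_pi, Measure.restrict_pi_pi]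

instance isProbabilityMeasure_shiftLaw (s : ℕ) : IsProbabilityMeasure (shiftLaw s) := by
  have : IsProbabilityMeasure ((volume : Measure ℝ).restrict (Set.Ico 0 1)) := ⟨by simp⟩
  rw [shiftLaw_eq_pi]
  infer_instance

lemma measurable_shiftedHalton {s : ℕ} (p : Fin s → ℕ) [∀ j, Fact (p j).Prime] :
    Measurable (shiftedHalton p) :=
  measurable_pi_iff.2 fun n => measurable_pi_iff.2 fun j =>
    ((measurable_shiftedPoint (p j) n).comp (measurable_pi_apply j)).subtype_mk

variable (γ : ℕ → ℝ≥0) {s : ℕ} (p : Fin s → ℕ) [∀ j, Fact (p j).Prime]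

lemma integrable_worstCaseError_shiftedHalton (N : ℕ) :
    Integrable (fun σ => worstCaseError γ s N (shiftedHalton p σ) ^ 2) (shiftLaw s) :=
  integrable_worstCaseError_sq γ s (shiftLaw s) N fun n =>
    (measurable_pi_apply n).comp (measurable_shiftedHalton p)

lemma integral_kernelMean_shiftedHalton (n : ℕ) :
    ∫ σ, kernelMean γ s (shiftedHalton p σ n) ∂(shiftLaw s)
      = ∏ i : Fin s, (1 + (γ (i + 1) : ℝ) / 3) := by
  rw [shiftLaw_eq_pi]
  refine (integral_fintype_prod_eq_prod (μ := fun _ => (volume : Measure ℝ).restrict (Set.Ico 0 1))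
    (f := fun (i : Fin s) (τ : ℝ) =>
      1 + (γ (i + 1) : ℝ) * ((1 - shiftedPoint (p i) n τ ^ 2) / 2))).trans ?_
  refine Finset.prod_congr rfl fun i _ => ?_
  rw [integral_comp_shiftedPoint (p i) (f := fun x => 1 + (γ (i + 1) : ℝ) * ((1 - x ^ 2) / 2))
    (by fun_prop), ← integral_unitInterval, integral_factor_sq]

lemma integral_sobolevKernelFun_shiftedHalton (n m : ℕ) :
    ∫ σ, sobolevKernelFun γ s (shiftedHalton p σ n) (shiftedHalton p σ m) ∂(shiftLaw s)
      = ∏ i : Fin s, (1 + (γ (i + 1) : ℝ) * shiftedMin (p i) n m) := by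
  rw [shiftLaw_eq_pi]
  refine (integral_fintype_prod_eq_prod (μ := fun _ => (volume : Measure ℝ).restrict (Set.Ico 0 1))
    (f := fun (i : Fin s) (τ : ℝ) => 1 + (γ (i + 1) : ℝ) *
      min (1 - shiftedPoint (p i) n τ) (1 - shiftedPoint (p i) m τ))).trans ?_
  refine Finset.prod_congr rfl fun i _ => ?_
  have h : Integrable (fun τ => (γ (i + 1) : ℝ) *
      min (1 - shiftedPoint (p i) n τ) (1 - shiftedPoint (p i) m τ))
      ((volume : Measure ℝ).restrict (Set.Ico 0 1)) :=
    (integrable_comp_shiftedPoint (p i) (F := fun q => min (1 - q.1) (1 - q.2))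
      (by fun_prop) n m).const_mul _
  rw [integral_add (integrable_const 1) h, integral_const_mul, shiftedMin]
  simp

/-- The mixed term averages to `-2` times the product that the constant term contributes once, so
one negative copy remains. -/
lemma integral_worstCaseError_sq {N : ℕ} (hN : 1 ≤ N) :
    (N : ℝ) ^ 2 * ∫ σ, worstCaseError γ s N (shiftedHalton p σ) ^ 2 ∂(shiftLaw s)
      = ∑ n ∈ Finset.range N, ∑ m ∈ Finset.range N,
          ∏ i : Fin s, (1 + (γ (i + 1) : ℝ) * shiftedMin (p i) n m)
        - (N : ℝ) ^ 2 * ∏ i : Fin s, (1 + (γ (i + 1) : ℝ) / 3) := by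
  have hN' : (N : ℝ) ≠ 0 := by positivity
  have hS : ∀ n, Measurable fun σ => shiftedHalton p σ n := fun n =>
    (measurable_pi_apply n).comp (measurable_shiftedHalton p)
  have hbound : ∀ {f : UnitCube s × UnitCube s → ℝ}, Continuous f → ∀ n m,
      Integrable (fun σ => f (shiftedHalton p σ n, shiftedHalton p σ m)) (shiftLaw s) := by
    intro f hf n m
    obtain ⟨C, hC⟩ := isCompact_univ.exists_bound_of_continuousOn hf.continuousOn
    exact Integrable.of_bound (hf.measurable.comp ((hS n).prodMk (hS m))).aestronglyMeasurable C
      (ae_of_all _ fun σ => hC _ trivial)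
  have h1 : ∀ n, Integrable (fun σ => kernelMean γ s (shiftedHalton p σ n)) (shiftLaw s) :=
    fun n => hbound ((continuous_kernelMean γ s).comp continuous_fst) n n
  have h2 : ∀ n m, Integrable (fun σ => sobolevKernelFun γ s (shiftedHalton p σ n)
      (shiftedHalton p σ m)) (shiftLaw s) :=
    fun n m => hbound (continuous_sobolevKernelFun γ s) n m
  have i1 : Integrable (fun σ => ∑ n ∈ Finset.range N, kernelMean γ s (shiftedHalton p σ n))
      (shiftLaw s) := integrable_finsetSum _ fun n _ => h1 n
  have i2' : ∀ n, Integrable (fun σ => ∑ m ∈ Finset.range N,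
      sobolevKernelFun γ s (shiftedHalton p σ n) (shiftedHalton p σ m)) (shiftLaw s) :=
    fun n => integrable_finsetSum _ fun m _ => h2 n m
  have i2 : Integrable (fun σ => ∑ n ∈ Finset.range N, ∑ m ∈ Finset.range N,
      sobolevKernelFun γ s (shiftedHalton p σ n) (shiftedHalton p σ m)) (shiftLaw s) :=
    integrable_finsetSum _ fun n _ => i2' n
  have ic : Integrable (fun _ => ∏ i : Fin s, (1 + (γ (i + 1) : ℝ) / 3)) (shiftLaw s) :=
    integrable_const _
  have i3 : Integrable (fun σ => ∏ i : Fin s, (1 + (γ (i + 1) : ℝ) / 3)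
      - 2 / N * ∑ n ∈ Finset.range N, kernelMean γ s (shiftedHalton p σ n)) (shiftLaw s) :=
    ic.sub (i1.const_mul _)
  simp_rw [worstCaseError_sq]
  rw [integral_add i3 (i2.const_mul _), integral_sub ic (i1.const_mul _),
    integral_const_mul, integral_const_mul, integral_finsetSum _ fun n _ => h1 n,
    integral_finsetSum _ fun n _ => i2' n]
  simp_rw [integral_finsetSum _ fun m _ => h2 _ m, integral_kernelMean_shiftedHalton,
    integral_sobolevKernelFun_shiftedHalton]
  simp
  field_simp
  ring

lemma integral_worstCaseError_sq_le (hcop : Pairwise fun i j => Nat.Coprime (p i) (p j)) {δ : ℝ}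
    (hδ : 0 < δ) (hδ1 : δ ≤ 1) {N : ℕ} (hN : 1 ≤ N) :
    (N : ℝ) ^ 2 * ∫ σ, worstCaseError γ s N (shiftedHalton p σ) ^ 2 ∂(shiftLaw s)
      ≤ (N : ℝ) ^ δ * ∏ i : Fin s,
        (1 + (γ (i + 1) : ℝ) * (1 / 3 + (p i : ℝ) ^ 2 / (6 * δ * Real.log (p i)))) := by
  rw [integral_worstCaseError_sq γ p hN]
  have hp : ∀ j, 2 ≤ p j := fun j => (Fact.out : (p j).Prime).two_le
  -- The bound for kernels truncated at level `G` does not depend on `G`, so it passes to the limit.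
  refine le_of_tendsto (x := (atTop : Filter ℕ)) ?_ (Eventually.of_forall fun G => sum_sum_prod_sub_le hp hcop
    (c := fun i : Fin s => (γ (i + 1) : ℝ)) (fun i => (γ (i + 1)).coe_nonneg) hδ hδ1 N G)
  refine Tendsto.sub_const (tendsto_finsetSum _ fun n _ => tendsto_finsetSum _ fun m _ =>
    tendsto_finsetProd _ fun i _ => ?_) _
  refine (((tendsto_sum_levelKernel (p i) n m).const_mul (γ (i + 1) : ℝ)).const_add 1).congr
    fun G => ?_
  ring

end Halton

/-! ### The growth of the primes -/

section Primes

lemma primeCounting_nth_prime (i : ℕ) : Nat.primeCounting (Nat.nth Nat.Prime i) = i + 1 := by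
  rw [Nat.primeCounting, Nat.primeCounting', Nat.count_succ, if_pos (Nat.prime_nth_prime i),
    Nat.count_nth_of_infinite Nat.infinite_setOfPred_prime]

lemma lt_nth_prime (i : ℕ) : i + 1 < Nat.nth Nat.Prime i := by
  have := Nat.add_two_le_nth_prime i
  lia

/-- Chebyshev's lower bound for the prime counting function gives `P ≤ 3 n log P`. With `log P ≤ 2
√P` this yields `P ≤ 64 n ^ 2`, hence `log P ≤ 8 log n`, and `24 = 3 * 8`. -/
lemma nth_prime_le {i : ℕ} (hi : 1 ≤ i) :
    (Nat.nth Nat.Prime i : ℝ) ≤ 24 * (((i + 1 : ℕ) : ℝ) * Real.log ((i + 1 : ℕ) : ℝ)) := by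
  set P := Nat.nth Nat.Prime i with hP
  set n : ℕ := i + 1 with hn
  have hPn : n < P := lt_nth_prime i
  have hP2 : (2 : ℝ) ≤ P := by exact_mod_cast (by lia : 2 ≤ P)
  have hn2 : (2 : ℝ) ≤ n := by exact_mod_cast (by lia : 2 ≤ n)
  have hlogP : 0 < Real.log P := Real.log_pos (by linarith)
  have hlog2 := Real.log_two_gt_d9
  have h1 := Chebyshev.pi_ge P
  rw [primeCounting_nth_prime, div_le_iff₀ hlogP, ← hn] at h1
  have h2 : Real.log ((P : ℝ) + 1) ≤ 2 * Real.log P := by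
    rw [← Real.log_rpow (by linarith)]
    refine Real.log_le_log (by linarith) ?_
    norm_cast
    have : 2 ≤ P := by lia
    nlinarith
  have h3 : (P : ℝ) ≤ 3 * (n * Real.log P) := by
    have : (P : ℝ) * Real.log 2 ≤ 2 * (n * Real.log P) := by nlinarith
    nlinarith
  have hsq : √(P : ℝ) * √(P : ℝ) = P := Real.mul_self_sqrt (by linarith)
  have hsqpos : 0 < √(P : ℝ) := Real.sqrt_pos.2 (by linarith)
  have h4 : Real.log P ≤ 2 * √(P : ℝ) := by
    have := Real.log_le_self hsqpos.le
    rw [Real.log_sqrt (by linarith)] at this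
    linarith
  have h5 : √(P : ℝ) ≤ 6 * n := by
    have : √(P : ℝ) * √(P : ℝ) ≤ 6 * n * √(P : ℝ) := by
      rw [hsq]
      nlinarith
    exact le_of_mul_le_mul_right this hsqpos
  have h6 : (P : ℝ) ≤ 64 * (n : ℝ) ^ 2 := by nlinarith
  have h7 : Real.log P ≤ 8 * Real.log n := by
    have hlogn : Real.log 2 ≤ Real.log n := Real.log_le_log (by norm_num) hn2
    have h64 : Real.log 64 = 6 * Real.log 2 := by
      rw [show (64 : ℝ) = 2 ^ 6 by norm_num, Real.log_pow]
      norm_num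
    have := Real.log_le_log (by linarith) h6
    rw [Real.log_mul (by norm_num) (by positivity), Real.log_pow, h64] at this
    push_cast at this
    linarith
  nlinarith

/-- One of the two logarithms in the square cancels against `log p ≥ log (i + 1)`. What remains is
the growth in the hypothesis on the weights. -/
lemma sq_div_log_nth_prime_le {i : ℕ} (hi : 1 ≤ i) :
    (Nat.nth Nat.Prime i : ℝ) ^ 2 / Real.log (Nat.nth Nat.Prime i)
      ≤ 576 * (((i + 1 : ℕ) : ℝ) ^ 2 * Real.log ((i + 1 : ℕ) : ℝ)) := by
  have h1 := nth_prime_le hi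
  have hn2 : (2 : ℝ) ≤ (i + 1 : ℕ) := by exact_mod_cast (by lia : 2 ≤ i + 1)
  have hlogn : 0 < Real.log ((i + 1 : ℕ) : ℝ) := Real.log_pos (by linarith)
  have hP : ((i + 1 : ℕ) : ℝ) ≤ Nat.nth Nat.Prime i := by exact_mod_cast (lt_nth_prime i).le
  have hlog : Real.log ((i + 1 : ℕ) : ℝ) ≤ Real.log (Nat.nth Nat.Prime i) :=
    Real.log_le_log (by linarith) hP
  rw [div_le_iff₀ (hlogn.trans_le hlog)]
  calc (Nat.nth Nat.Prime i : ℝ) ^ 2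
      ≤ (24 * (((i + 1 : ℕ) : ℝ) * Real.log ((i + 1 : ℕ) : ℝ))) ^ 2 := by gcongr
    _ = 576 * (((i + 1 : ℕ) : ℝ) ^ 2 * Real.log ((i + 1 : ℕ) : ℝ)) *
        Real.log ((i + 1 : ℕ) : ℝ) := by ring
    _ ≤ _ := by gcongr

lemma one_le_sq_div_log_nth_prime (i : ℕ) :
    1 ≤ (Nat.nth Nat.Prime i : ℝ) ^ 2 / Real.log (Nat.nth Nat.Prime i) := by
  have h : (1 : ℝ) < Nat.nth Nat.Prime i := by exact_mod_cast (Nat.prime_nth_prime i).one_lt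
  rw [le_div_iff₀ (Real.log_pos h), one_mul]
  have := Real.log_le_self (by linarith : (0 : ℝ) ≤ Nat.nth Nat.Prime i)
  nlinarith

lemma summable_weight_mul_prime {γ : ℕ → ℝ≥0}
    (hsum : Summable fun j : ℕ => (γ j : ℝ) * (j : ℝ) ^ 2 * Real.log j) {δ : ℝ} (hδ : 0 < δ) :
    Summable fun i : ℕ => (γ (i + 1) : ℝ) * (1 / 3 + (Nat.nth Nat.Prime i : ℝ) ^ 2 /
      (6 * δ * Real.log (Nat.nth Nat.Prime i))) := by
  have h1 : Summable fun i : ℕ => (γ (i + 1) : ℝ) *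
      ((Nat.nth Nat.Prime i : ℝ) ^ 2 / Real.log (Nat.nth Nat.Prime i)) := by
    -- The first prime is set aside: its comparison term would contain `log 1 = 0`.
    rw [← summable_nat_add_iff 1]
    refine Summable.of_nonneg_of_le (fun i => ?_) (fun i => ?_)
      (((summable_nat_add_iff 2).2 hsum).mul_left 576)
    · have := one_le_sq_div_log_nth_prime (i + 1)
      exact mul_nonneg (NNReal.coe_nonneg _) (by linarith)
    · refine (mul_le_mul_of_nonneg_left (sq_div_log_nth_prime_le (i := i + 1) (by lia))
        (NNReal.coe_nonneg _)).trans_eq ?_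
      push_cast
      ring_nf
  refine Summable.of_nonneg_of_le (fun i => ?_) (fun i => ?_)
    (h1.mul_left (1 / 3 + 1 / (6 * δ)))
  · have : 0 ≤ Real.log (Nat.nth Nat.Prime i) := Real.log_natCast_nonneg _
    positivity
  · have hA := one_le_sq_div_log_nth_prime i
    have hsplit : (Nat.nth Nat.Prime i : ℝ) ^ 2 / (6 * δ * Real.log (Nat.nth Nat.Prime i))
        = 1 / (6 * δ) * ((Nat.nth Nat.Prime i : ℝ) ^ 2 / Real.log (Nat.nth Nat.Prime i)) := by
      rw [div_mul_div_comm, one_mul]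
    rw [hsplit, mul_left_comm, add_mul]
    refine mul_le_mul_of_nonneg_left ?_ (NNReal.coe_nonneg _)
    linarith

end Primes

/-! ### The error bound uniform in the dimension -/

lemma prod_one_add_le_exp_tsum {x : ℕ → ℝ} (hx : ∀ i, 0 ≤ x i) (hs : Summable x) (s : ℕ) :
    ∏ i : Fin s, (1 + x i) ≤ Real.exp (∑' i, x i) := by
  calc ∏ i : Fin s, (1 + x i) ≤ ∏ i : Fin s, Real.exp (x i) :=
        Finset.prod_le_prod (fun i _ => by linarith [hx i]) fun i _ => by
          linarith [Real.add_one_le_exp (x i)]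
    _ = Real.exp (∑ i ∈ Finset.range s, x i) := by
        rw [← Real.exp_sum, Fin.sum_univ_eq_sum_range]
    _ ≤ _ := Real.exp_le_exp.2 (hs.sum_le_tsum _ fun i _ => hx i)

lemma coprime_firstPrimes (s : ℕ) :
    Pairwise fun i j : Fin s => Nat.Coprime (firstPrimes s i) (firstPrimes s j) := fun i j hij =>
  (Nat.coprime_primes (Nat.prime_nth_prime i) (Nat.prime_nth_prime j)).2 fun h =>
    hij (Fin.ext (Nat.nth_injective Nat.infinite_setOfPred_prime h))

/-- The error bound for the randomly shifted Halton sequence. -/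
lemma exists_haltonRMSError_le {γ : ℕ → ℝ≥0}
    (hsum : Summable fun j : ℕ => (γ j : ℝ) * (j : ℝ) ^ 2 * Real.log j) {δ : ℝ} (hδ : 0 < δ) :
    ∃ C : ℝ, 0 < C ∧ ∀ s N : ℕ, 1 ≤ N → haltonRMSError γ N s ≤ C / (N : ℝ) ^ (1 - δ) := by
  -- The mean square error is of order `N ^ (η - 2)`, so `η ≤ 2 * δ` suffices after the square root;
  -- the cap at `1` is required by `mod_div_le_rpow`.
  set η : ℝ := min (2 * δ) 1 with hη
  have hη0 : 0 < η := lt_min (by linarith) one_pos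
  have hη1 : η ≤ 1 := min_le_right _ _
  have hη2 : η ≤ 2 * δ := min_le_left _ _
  set x : ℕ → ℝ := fun i => (γ (i + 1) : ℝ) * (1 / 3 + (Nat.nth Nat.Prime i : ℝ) ^ 2 /
      (6 * η * Real.log (Nat.nth Nat.Prime i))) with hx
  have hx0 : ∀ i, 0 ≤ x i := fun i => by
    have : 0 ≤ Real.log (Nat.nth Nat.Prime i) := Real.log_natCast_nonneg _
    simp only [hx]
    positivity
  set E : ℝ := Real.exp (∑' i, x i) with hE
  have hE0 : 0 < E := Real.exp_pos _
  refine ⟨√E, Real.sqrt_pos.2 hE0, fun s N hN => ?_⟩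
  have hN1 : (1 : ℝ) ≤ N := by exact_mod_cast hN
  have hN0 : (0 : ℝ) < N := by linarith
  have h1 := integral_worstCaseError_sq_le γ (firstPrimes s) (coprime_firstPrimes s) hη0 hη1 hN
  have h2 : ∏ i : Fin s, (1 + (γ (i + 1) : ℝ) * (1 / 3 + (firstPrimes s i : ℝ) ^ 2 /
      (6 * η * Real.log (firstPrimes s i)))) ≤ E :=
    prod_one_add_le_exp_tsum hx0 (summable_weight_mul_prime hsum hη0) s
  rw [haltonRMSError, rmsWorstCaseError]
  refine Real.sqrt_le_iff.2 ⟨by positivity, ?_⟩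
  rw [div_pow, Real.sq_sqrt hE0.le, le_div_iff₀ (by positivity)]
  have h3 : ((N : ℝ) ^ (1 - δ)) ^ 2 = (N : ℝ) ^ 2 * (N : ℝ) ^ (-(2 * δ)) := by
    rw [← Real.rpow_natCast, ← Real.rpow_natCast, ← Real.rpow_mul hN0.le, ← Real.rpow_add hN0]
    congr 1
    push_cast
    ring
  have h4 : (N : ℝ) ^ η * (N : ℝ) ^ (-(2 * δ)) ≤ 1 := by
    rw [← Real.rpow_add hN0]
    exact Real.rpow_le_one_of_one_le_of_nonpos hN1 (by linarith)
  rw [h3, ← mul_assoc, mul_comm _ ((N : ℝ) ^ 2)]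
  calc (N : ℝ) ^ 2 * (∫ σ, worstCaseError γ s N (shiftedHalton (firstPrimes s) σ) ^ 2
        ∂(shiftLaw s)) * (N : ℝ) ^ (-(2 * δ))
      ≤ (N : ℝ) ^ η * E * (N : ℝ) ^ (-(2 * δ)) := by
        refine mul_le_mul_of_nonneg_right (h1.trans ?_) (by positivity)
        gcongr
    _ = (N : ℝ) ^ η * (N : ℝ) ^ (-(2 * δ)) * E := by ring
    _ ≤ E := mul_le_of_le_one_left hE0.le h4

/-! ### Tractability -/

section Tractability

open Filter Topology

variable {e : ℕ → ℕ → ℝ} {c : ErrorCriterion} {τ : ℝ}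

/-- A finite bound rules out the value `⊤`, and the infimum of a nonempty subset of `ℕ∞` is
attained. -/
lemma exists_le_of_stronglyTractableWith {C ε : ℝ} {s : ℕ} (hC : 0 ≤ C * ε ^ (-τ))
    (h : (infoComplexity e c ε s : ℝ≥0∞) ≤ ENNReal.ofReal (C * ε ^ (-τ))) :
    ∃ N : ℕ, (N : ℝ) ≤ C * ε ^ (-τ) ∧ e N s ≤ ε * c.scale e s := by
  have hne : {n : ℕ∞ | ∃ N : ℕ, n = N ∧ e N s ≤ ε * c.scale e s}.Nonempty := by
    by_contra hne
    rw [infoComplexity, Set.not_nonempty_iff_eq_empty.1 hne, sInf_empty] at h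
    simp at h
  obtain ⟨N, hN, hle⟩ := csInf_mem hne
  refine ⟨N, ?_, hle⟩
  rw [infoComplexity, hN] at h
  have h' : ENNReal.ofReal (N : ℝ) ≤ ENNReal.ofReal (C * ε ^ (-τ)) := by
    simpa using h
  exact (ENNReal.ofReal_le_ofReal_iff hC).1 h'

/-- Errors of order at least `1 / N` exclude tractability bounds with exponents less than one. -/
lemma one_le_of_stronglyTractableWith {a : ℝ} (ha : 0 < a)
    (hlow : ∀ N : ℕ, a / (N + 1) ≤ e N 1) (h : StronglyTractableWith e c τ) : 1 ≤ τ := by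
  by_contra! hτ
  obtain ⟨C, hC, hbound⟩ := h
  set κ := c.scale e 1 with hκ
  have hκ0 : 0 < κ := by
    cases c with
    | absolute => exact one_pos
    | normalized => exact lt_of_lt_of_le (by simpa using ha) (hlow 0)
  -- For `τ < 1` the right side tends to zero with `ε`, a contradiction. The denominator `N + 1` in
  -- the lower bound also covers the zero rule.
  have hev : ∀ᶠ ε : ℝ in 𝓝[>] 0, a ≤ κ * (C * ε ^ (1 - τ) + ε) := by
    filter_upwards [Ioo_mem_nhdsGT (zero_lt_one' ℝ)] with ε hε
    obtain ⟨N, hN, hle⟩ := exists_le_of_stronglyTractableWith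
      (mul_nonneg hC.le (Real.rpow_nonneg hε.1.le _)) (hbound 1 le_rfl ε hε.1 hε.2)
    have h1 := (hlow N).trans hle
    rw [div_le_iff₀ (by positivity)] at h1
    have h2 : ε ^ (1 - τ) = ε * ε ^ (-τ) := by
      rw [sub_eq_add_neg, Real.rpow_add hε.1, Real.rpow_one]
    calc a ≤ ε * κ * (N + 1) := h1
      _ ≤ ε * κ * (C * ε ^ (-τ) + 1) := by
        have := hε.1
        gcongr
      _ = κ * (C * ε ^ (1 - τ) + ε) := by rw [h2]; ring
  have hlim : Tendsto (fun ε : ℝ => κ * (C * ε ^ (1 - τ) + ε)) (𝓝[>] 0) (𝓝 0) := by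
    have hcont : Continuous fun ε : ℝ => κ * (C * ε ^ (1 - τ) + ε) := by
      have := Real.continuous_rpow_const (by linarith : 0 ≤ 1 - τ)
      fun_prop
    have := (hcont.tendsto 0).mono_left (nhdsWithin_le_nhds (s := Set.Ioi 0))
    simpa [Real.zero_rpow (by linarith : 1 - τ ≠ 0)] using this
  linarith [ge_of_tendsto hlim hev]

lemma stronglyTractableWith_of_le {C : ℝ} (hC : 0 < C) (hτ : 0 < τ)
    (hscale : ∀ s, 1 ≤ c.scale e s)
    (hle : ∀ s N : ℕ, 1 ≤ N → e N s ≤ C / (N : ℝ) ^ (1 / τ)) : StronglyTractableWith e c τ := by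
  -- The summand `1` absorbs the rounding up of `N`, since `ε ^ (-τ) ≥ 1`.
  refine ⟨C ^ τ + 1, by positivity, fun s _ ε hε hε1 => ?_⟩
  set N := ⌈(C / ε) ^ τ⌉₊ with hN
  have hpos : 0 < (C / ε) ^ τ := by positivity
  have hN1 : 1 ≤ N := Nat.one_le_ceil_iff.2 hpos
  have hNge : (C / ε) ^ τ ≤ N := Nat.le_ceil _
  have herr : e N s ≤ ε * c.scale e s := by
    have h1 : C / ε ≤ (N : ℝ) ^ (1 / τ) := by
      have := Real.rpow_le_rpow hpos.le hNge (by positivity : 0 ≤ 1 / τ)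
      rwa [← Real.rpow_mul (by positivity), mul_one_div_cancel hτ.ne', Real.rpow_one] at this
    calc e N s ≤ C / (N : ℝ) ^ (1 / τ) := hle s N hN1
      _ ≤ C / (C / ε) := by gcongr
      _ = ε := by field_simp
      _ ≤ ε * c.scale e s := le_mul_of_one_le_right hε.le (hscale s)
  have hinfo : infoComplexity e c ε s ≤ (N : ℕ∞) := sInf_le ⟨N, rfl, herr⟩
  have hNle : (N : ℝ) ≤ (C ^ τ + 1) * ε ^ (-τ) := by
    have h1 : (N : ℝ) < (C / ε) ^ τ + 1 := Nat.ceil_lt_add_one hpos.le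
    have h2 : (C / ε) ^ τ = C ^ τ * ε ^ (-τ) := by
      rw [Real.div_rpow hC.le hε.le, Real.rpow_neg hε.le, div_eq_mul_inv]
    have h3 : 1 ≤ ε ^ (-τ) := Real.one_le_rpow_of_pos_of_le_one_of_nonpos hε hε1.le (by linarith)
    linarith
  calc (infoComplexity e c ε s : ℝ≥0∞) ≤ ((N : ℕ∞) : ℝ≥0∞) := by exact_mod_cast hinfo
    _ = ENNReal.ofReal (N : ℝ) := by simp
    _ ≤ _ := ENNReal.ofReal_le_ofReal hNle

end Tractability

/-! ### Root mean square errors of random rules -/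

section RandomRules

variable (γ : ℕ → ℝ≥0) {Ω : Type*} [MeasurableSpace Ω] (P : Measure Ω) [IsProbabilityMeasure P]

lemma rmsWorstCaseError_zero (s : ℕ) (S : Ω → ℕ → UnitCube s) :
    rmsWorstCaseError P γ s 0 S = √(∏ i : Fin s, (1 + (γ (i + 1) : ℝ) / 3)) := by
  simp [rmsWorstCaseError, worstCaseError_zero_sq]

lemma one_le_rmsWorstCaseError_zero (s : ℕ) (S : Ω → ℕ → UnitCube s) :
    1 ≤ rmsWorstCaseError P γ s 0 S := by
  rw [rmsWorstCaseError_zero, Real.one_le_sqrt]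
  refine (Finset.prod_const_one (s := (Finset.univ : Finset (Fin s)))).ge.trans
    (Finset.prod_le_prod (fun _ _ => zero_le_one) fun i _ => ?_)
  have := (γ (i + 1)).coe_nonneg
  linarith [div_nonneg this (by norm_num : (0 : ℝ) ≤ 3)]

/-- Random rules in dimension one have root mean square errors of order at least `1 / N`. -/
lemma le_rmsWorstCaseError_one {S : Ω → ℕ → UnitCube 1} (hS : Measurable S) (N : ℕ) :
    √(min 1 (γ 1 / (2 * Real.pi ^ 2))) / (N + 1) ≤ rmsWorstCaseError P γ 1 N S := by
  have hmin : 0 ≤ min 1 ((γ 1 : ℝ) / (2 * Real.pi ^ 2)) :=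
    le_min zero_le_one (div_nonneg (NNReal.coe_nonneg _) (by positivity))
  rcases Nat.eq_zero_or_pos N with rfl | hN
  -- For `N = 0` the error is the initial error, at least `1`; hence the minimum with `1` in the
  -- constant.
  · refine le_trans ?_ (one_le_rmsWorstCaseError_zero γ P 1 S)
    simp [Real.sqrt_le_one]
  · have hN0 : (0 : ℝ) < N := by exact_mod_cast hN
    rw [rmsWorstCaseError]
    refine Real.le_sqrt_of_sq_le ?_
    have hle : ∀ ω, γ 1 / (2 * Real.pi ^ 2 * (N : ℝ) ^ 2) ≤ worstCaseError γ 1 N (S ω) ^ 2 :=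
      fun ω => worstCaseError_one_sq_ge γ hN (S ω)
    have hint := integrable_worstCaseError_sq γ 1 P N fun n =>
      (measurable_pi_apply n).comp hS
    have h1 := integral_mono (integrable_const _) hint hle
    rw [integral_const] at h1
    simp only [probReal_univ, one_smul] at h1
    refine le_trans ?_ h1
    rw [div_pow, Real.sq_sqrt hmin, ← div_div (γ 1 : ℝ) (2 * Real.pi ^ 2)]
    have h2 := min_le_right 1 ((γ 1 : ℝ) / (2 * Real.pi ^ 2))
    have h3 : 0 ≤ (γ 1 : ℝ) / (2 * Real.pi ^ 2) :=
      div_nonneg (NNReal.coe_nonneg _) (by positivity)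
    gcongr
    linarith

/-- Dimension one alone excludes exponents below one. -/
lemma one_le_of_stronglyTractableWith_rms (hγ : 0 < γ 1) {Ω : ℕ → Type*}
    [∀ s, MeasurableSpace (Ω s)] (P : ∀ s, Measure (Ω s)) [∀ s, IsProbabilityMeasure (P s)]
    {S : ∀ s, Ω s → ℕ → UnitCube s} (hS : ∀ s, Measurable (S s)) {c : ErrorCriterion} {τ : ℝ}
    (h : StronglyTractableWith (fun N s => rmsWorstCaseError (P s) γ s N (S s)) c τ) : 1 ≤ τ := by
  have hγ' : (0 : ℝ) < γ 1 := hγ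
  exact one_le_of_stronglyTractableWith
    (a := √(min 1 (γ 1 / (2 * Real.pi ^ 2)))) (Real.sqrt_pos.2 (lt_min one_pos (by positivity)))
    (fun N => le_rmsWorstCaseError_one γ (P 1) (hS 1) N) h

end RandomRules

/-- The initial error is at least one, so the normalized criterion asks no more than the absolute
one. -/
lemma one_le_scale_haltonRMSError (γ : ℕ → ℝ≥0) (c : ErrorCriterion) (s : ℕ) :
    1 ≤ c.scale (haltonRMSError γ) s := by
  cases c with
  | absolute => exact le_rfl
  | normalized => exact one_le_rmsWorstCaseError_zero γ (shiftLaw s) s _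

lemma hasEpsExponent_haltonRMSError {γ : ℕ → ℝ≥0} (hγ : 0 < γ 1)
    (hsum : Summable fun j : ℕ => (γ j : ℝ) * (j : ℝ) ^ 2 * Real.log j) (c : ErrorCriterion) :
    HasEpsExponent (haltonRMSError γ) c 1 := by
  refine ⟨fun τ hτ => one_le_of_stronglyTractableWith_rms γ hγ shiftLaw
    (fun s => measurable_shiftedHalton (firstPrimes s)) hτ.2, fun b hb => ?_⟩
  -- The exponent `1` itself need not be admissible; every `τ > 1` is, through the rate `N ^ (-(1 /
  -- τ))` given by `δ = 1 - 1 / τ`.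
  refine le_of_forall_gt_imp_ge_of_dense fun τ hτ => hb ⟨by linarith, ?_⟩
  have hτ0 : 0 < τ := by linarith
  obtain ⟨C, hC, hle⟩ := exists_haltonRMSError_le hsum (δ := 1 - 1 / τ)
    (sub_pos.2 ((div_lt_one hτ0).2 hτ))
  refine stronglyTractableWith_of_le hC hτ0 (one_le_scale_haltonRMSError γ c) fun s N hN => ?_
  simpa using hle s N hN

end HaltonQMC

theorem mainTheorem5 (γ : ℕ → ℝ≥0) (hγ : ∀ j, 1 ≤ j → 0 < γ j)
    (hsum : Summable fun j : ℕ => (γ j : ℝ) * (j : ℝ) ^ 2 * Real.log j) :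
    -- the mean over the shift is a mean of an integrable function
    (∀ N s : ℕ, MeasureTheory.Integrable
      (fun σ => HaltonQMC.worstCaseError γ s N
        (HaltonQMC.shiftedHalton (HaltonQMC.firstPrimes s) σ) ^ 2) (HaltonQMC.shiftLaw s)) ∧
    -- the error bound, with a constant independent of the dimension
    (∀ δ : ℝ, 0 < δ → ∃ C : ℝ, 0 < C ∧ ∀ s : ℕ, 1 ≤ s → ∀ N : ℕ, 1 ≤ N →
      HaltonQMC.haltonRMSError γ N s ≤ C / (N : ℝ) ^ (1 - δ)) ∧
    -- strong polynomial tractability with exponent one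
    (∀ c : HaltonQMC.ErrorCriterion,
      HaltonQMC.HasEpsExponent (HaltonQMC.haltonRMSError γ) c 1) ∧
    -- optimality among all, possibly randomized, rules of open type: no smaller exponent
    (∀ (Ω : ℕ → Type) [∀ s, MeasurableSpace (Ω s)] (P : ∀ s, MeasureTheory.Measure (Ω s))
      [∀ s, MeasureTheory.IsProbabilityMeasure (P s)]
      (S : ∀ s, Ω s → ℕ → HaltonQMC.UnitCube s), (∀ s, Measurable (S s)) →
      ∀ (c : HaltonQMC.ErrorCriterion) (τ : ℝ),
        HaltonQMC.StronglyTractableWith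
          (fun N s => HaltonQMC.rmsWorstCaseError (P s) γ s N (S s)) c τ → 1 ≤ τ) ∧
    -- optimality of the rate: no sequence has errors of order smaller than `1 / N`
    (∀ s : ℕ, 1 ≤ s → ∀ S : ℕ → HaltonQMC.UnitCube s,
      ¬ Asymptotics.IsLittleO Filter.atTop
        (fun N : ℕ => HaltonQMC.worstCaseError γ s N S) (fun N : ℕ => 1 / (N : ℝ))) := by
  have hγ1 : 0 < γ 1 := hγ 1 le_rfl
  refine ⟨fun N s => HaltonQMC.integrable_worstCaseError_shiftedHalton γ
    (HaltonQMC.firstPrimes s) N, fun δ hδ => ?_,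
    HaltonQMC.hasEpsExponent_haltonRMSError hγ1 hsum, ?_, ?_⟩
  · obtain ⟨C, hC, hle⟩ := HaltonQMC.exists_haltonRMSError_le hsum hδ
    exact ⟨C, hC, fun s _ N hN => hle s N hN⟩
  · intro Ω _ P _ S hS c τ h
    exact HaltonQMC.one_le_of_stronglyTractableWith_rms γ hγ1 P hS h
  · intro s hs S
    obtain ⟨s, rfl⟩ := Nat.exists_eq_add_of_le' hs
    exact HaltonQMC.not_isLittleO_worstCaseError γ s hγ1 S
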